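/- For real $r\ge 1$ and $n\in\mathbb N=\{1,2,3,\dots\}$ let $\sigma_{-r}(n)=\sum_{d\mid n}d^{-r}$, and let $C_r$ be the number of connected components of the closure $\overline{\sigma_{-r}(\mathbb N)}$ of the set $\sigma_{-r}(\mathbb N)=\{\sigma_{-r}(n):n\in\mathbb N\}$ in $\mathbb R$. A prime $p$ is called $r$-mighty if $$1+\frac1{p^r}>\prod_{\substack{q\text{ prime}\\ q>p}}\frac1{1-q^{-r}},$$ where the product is taken to be $+\infty$ if it diverges (so no prime is $1$-mighty). **Theorem.** Let $r\ge 1$ be real. Then: 1. $C_r\ne 4$. 2. If the largest $r$-mighty prime is $3$, then $C_r\le 3$. 3. If there are at least three $r$-mighty primes, then $C_r\ge 5$. -/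

import Mathlib

/-- The divisor function `σ_{-r}(n) = ∑_{d ∣ n} d^{-r}`, for positive integers `n`. -/
noncomputable def sigmaNeg (r : ℝ) (n : ℕ+) : ℝ :=
  ∑ d ∈ (n : ℕ).divisors, (d : ℝ) ^ (-r)

/-- The topological closure in `ℝ` of the range of `σ_{-r}` on the positive integers. -/
def sigmaClosure (r : ℝ) : Set ℝ :=
  closure (Set.range (sigmaNeg r))

/-- The number `C_r` of connected components of the closure of the range of `σ_{-r}`
(as a subspace of `ℝ`), `⊤` if there are infinitely many. -/
noncomputable def numComponents (r : ℝ) : ℕ∞ :=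
  ENat.card (ConnectedComponents (sigmaClosure r))

/-- A prime `p` is `r`-mighty if `1 + p^{-r} > ∏_{q > p prime} 1 / (1 - q^{-r})`.
For `r > 0` all factors exceed `1`, and the product is taken in `[0, ∞]`, so that it is `∞`
when it diverges (as it does for `r = 1`). -/
def IsMighty (r : ℝ) (p : ℕ) : Prop :=
  p.Prime ∧
    ∏' q : {q : ℕ // q.Prime ∧ p < q}, ENNReal.ofReal (1 / (1 - ((q : ℕ) : ℝ) ^ (-r))) <
      ENNReal.ofReal (1 + (p : ℝ) ^ (-r))

/-! Everything follows from a dichotomy: if no prime above 3 is mighty, then `C_r ≤ 3`; if some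
prime `p ≥ 5` is mighty, then `C_r ≥ 5`. The value 4 is thus skipped, and three mighty primes must
include one that is at least 5.

Suppose `p ≥ 5` is mighty. Then `r > 2`, because for `r ≤ 2` the primes just above `p` already make
the tail product too large (`exists_primes_sum_sq`, `not_isMighty_of_le_two`). For `r ≥ 2` the
primes 2 and 3 are mighty as well, by comparison with `ζ(2)`. Each mighty prime `q` opens a gap just
below `σ(q)`: integers with all prime factors above `q` stay under the tail product, all others
reach `1 + q^{-r}`. Scaling the gap of `p` by `σ(2)` gives a fourth gap, just below `σ(2p)`. Four
gaps separate five values (`five_le_numComponents`).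

Suppose no prime above 3 is mighty. Then `r < 5/2`, since 5 is mighty from `5/2` on
(`isMighty_five`). A greedy choice of exponents shows that the closure `J` of the values at integers
prime to 6 is an interval (`ordConnected_roughClosure`). Since 5 is not mighty, `J` contains `[1, 1
+ 2·5^{-r}]`. The whole closure is the closure of the union of the sets `σ(2^j) σ(3^k) J`. Raising a
positive exponent of 2 or 3 by one moves such a set so little that it overlaps the previous one, so
only passing from exponent 0 to 1 can leave a gap. This gives four connected families, according to
whether `j` and `k` vanish, and the two with `j ≥ 1` meet (`numComponents_le_three`). -/

/-! ### Primes shortly after a given prime -/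

/-- `K²` primes in `(p, K p]` already make the sum of `(p / q)²` at least `1`. -/
theorem one_le_sum_sq_of_card {p K : ℕ} (hp : 0 < p) (hK : 0 < K) (F : Finset ℕ)
    (hF : ∀ q ∈ F, p < q ∧ q ≤ K * p) (hc : K ^ 2 ≤ F.card) :
    1 ≤ ∑ q ∈ F, ((p : ℝ) / q) ^ 2 := by
  have hK' : (0 : ℝ) < K := by exact_mod_cast hK
  have hp' : (0 : ℝ) < p := by exact_mod_cast hp
  have h1 : ∀ q ∈ F, (1 / (K : ℝ)) ^ 2 ≤ ((p : ℝ) / q) ^ 2 := by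
    intro q hq
    obtain ⟨h1, h2⟩ := hF q hq
    have hq' : (0 : ℝ) < q := by exact_mod_cast hp.trans h1
    have h2' : (q : ℝ) ≤ K * p := by exact_mod_cast h2
    gcongr ?_ ^ 2
    rw [div_le_div_iff₀ hK' hq']
    linarith
  have h2 := Finset.card_nsmul_le_sum F _ _ h1
  have h3 : ((K : ℝ)) ^ 2 ≤ F.card := by exact_mod_cast hc
  refine le_trans ?_ h2
  rw [nsmul_eq_mul, one_div, inv_pow, ← div_eq_mul_inv, le_div_iff₀ (by positivity)]
  linarith

/-- One explicit list of `K²` primes in `(b, K a]` serves every `p` in `[a, b]`, which leaves few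
lists to check. -/
theorem exists_primes_sum_sq_of_block {a b p K : ℕ} (ha : 0 < a) (hK : 0 < K) (F : Finset ℕ)
    (hF : ∀ q ∈ F, q.Prime) (hb : ∀ q ∈ F, b < q ∧ q ≤ K * a) (hc : K ^ 2 ≤ F.card)
    (hap : a ≤ p) (hpb : p ≤ b) :
    ∃ F : Finset ℕ, (∀ q ∈ F, q.Prime ∧ p < q) ∧ 1 ≤ ∑ q ∈ F, ((p : ℝ) / q) ^ 2 := by
  have h : ∀ q ∈ F, p < q ∧ q ≤ K * p := fun q hq ↦
    ⟨hpb.trans_lt (hb q hq).1, (hb q hq).2.trans (Nat.mul_le_mul_left K hap)⟩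
  exact ⟨F, fun q hq ↦ ⟨hF q hq, (h q hq).1⟩, one_le_sum_sq_of_card (by omega) hK F h hc⟩

/-- Take `K = m = ⌊√p⌋`. As `m² ≤ p`, it is enough to find `p` primes in `(p, m p]`, and Chebyshev's
lower bound gives at least `2 p` primes up to `m p`. -/
theorem exists_primes_sum_sq_of_large {p : ℕ} (hp : 1600 ≤ p) :
    ∃ F : Finset ℕ, (∀ q ∈ F, q.Prime ∧ p < q) ∧ 1 ≤ ∑ q ∈ F, ((p : ℝ) / q) ^ 2 := by
  set m := Nat.sqrt p with hm
  have hm40 : 40 ≤ m := Nat.le_sqrt.2 (by omega)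
  have hm1 : m * m ≤ p := Nat.sqrt_le p
  have hm2 : p < (m + 1) * (m + 1) := Nat.lt_succ_sqrt p
  have hm40' : (40 : ℝ) ≤ m := by exact_mod_cast hm40
  have hm1' : (m : ℝ) * m ≤ p := by exact_mod_cast hm1
  have hm2' : (p : ℝ) < (m + 1) * (m + 1) := by exact_mod_cast hm2
  have hN : m * p + 1 ≤ (m + 1) ^ 3 := by nlinarith
  have hN' : ((m * p : ℕ) : ℝ) + 1 ≤ ((m : ℝ) + 1) ^ 3 := by exact_mod_cast hN
  have hp0 : (1600 : ℝ) ≤ p := by exact_mod_cast hp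
  have hN1 : (1 : ℝ) < ((m * p : ℕ) : ℝ) := by push_cast; nlinarith
  set L := Real.log ((m : ℝ) + 1) with hL
  have hL1 : Real.log (((m * p : ℕ) : ℝ) + 1) ≤ 3 * L := by
    have := Real.log_le_log (by linarith) hN'
    rwa [Real.log_pow] at this
  have hL2 : Real.log ((m * p : ℕ) : ℝ) ≤ 3 * L :=
    (Real.log_le_log (by linarith) (by linarith)).trans hL1
  -- This is `log x ≤ x / e³ + 2` with `e³ ≥ 20`. The slope `1/20` costs `0.3 m p` in the Chebyshev
  -- bound, against a main term of at least `0.69 m p`.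
  have hLm : L ≤ (m + 1) / 20 + 2 := by
    have he : (20 : ℝ) ≤ Real.exp 3 := by
      have h := Real.exp_one_gt_d9
      have h3 : Real.exp 3 = Real.exp 1 ^ 3 := by
        rw [← Real.exp_nat_mul]; norm_num
      rw [h3]
      have : (2.718 : ℝ) ^ 3 ≤ Real.exp 1 ^ 3 := by gcongr; linarith
      norm_num at this ⊢
      linarith
    have h1 := Real.log_le_sub_one_of_pos (x := ((m : ℝ) + 1) / Real.exp 3) (by positivity)
    rw [Real.log_div (by positivity) (by positivity), Real.log_exp] at h1
    have h2 : ((m : ℝ) + 1) / Real.exp 3 ≤ (m + 1) / 20 := by gcongr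
    linarith
  have hlog2 := Real.log_two_gt_d9
  have hpi : (2 * p : ℝ) ≤ Nat.primeCounting (m * p) := by
    refine le_trans ?_ (Chebyshev.pi_ge (m * p))
    rw [le_div_iff₀ (Real.log_pos hN1)]
    have h1 : 2 * (p : ℝ) * Real.log ((m * p : ℕ) : ℝ) ≤ 2 * p * (3 * ((m + 1) / 20 + 2)) := by
      gcongr; linarith
    have h2 : 0.69 * ((m : ℝ) * p) ≤ ((m * p : ℕ) : ℝ) * Real.log 2 := by
      push_cast
      have : 0 ≤ (m : ℝ) * p := by positivity
      nlinarith
    nlinarith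
  have hpi' : 2 * p ≤ Nat.primeCounting (m * p) := by exact_mod_cast hpi
  set F := (Finset.Ioc p (m * p)).filter Nat.Prime with hF
  have hsub : Nat.primesLE (m * p) ⊆ Finset.Icc 1 p ∪ F := by
    intro q hq
    rw [Nat.mem_primesLE] at hq
    have := hq.2.pos
    simp only [hF, Finset.mem_union, Finset.mem_Icc, Finset.mem_filter, Finset.mem_Ioc]
    rcases le_or_gt q p with h | h
    · exact .inl ⟨this, h⟩
    · exact .inr ⟨⟨h, hq.1⟩, hq.2⟩
  have hcard := (Finset.card_le_card hsub).trans (Finset.card_union_le _ _)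
  rw [Nat.primesLE_card_eq_primeCounting, Nat.card_Icc] at hcard
  have hmem : ∀ q ∈ F, q.Prime ∧ p < q ∧ q ≤ m * p := by
    intro q hq
    simp only [hF, Finset.mem_filter, Finset.mem_Ioc] at hq
    exact ⟨hq.2, hq.1⟩
  refine ⟨F, fun q hq ↦ ⟨(hmem q hq).1, (hmem q hq).2.1⟩,
    one_le_sum_sq_of_card (K := m) (by omega) (by omega) F (fun q hq ↦ (hmem q hq).2) ?_⟩
  rw [sq]
  omega

/-- For each prime `p ≥ 5`, finitely many larger primes `q` have `∑ (p / q)² ≥ 1`. -/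
theorem exists_primes_sum_sq {p : ℕ} (hp : p.Prime) (h5 : 5 ≤ p) :
    ∃ F : Finset ℕ, (∀ q ∈ F, q.Prime ∧ p < q) ∧ 1 ≤ ∑ q ∈ F, ((p : ℝ) / q) ^ 2 := by
  rcases le_or_gt 1600 p with h | h
  · exact exists_primes_sum_sq_of_large h
  rcases le_or_gt 367 p with h' | h'
  · exact exists_primes_sum_sq_of_block (a := 367) (b := 1600) (K := 5) (by norm_num) (by norm_num)
      {1601, 1607, 1609, 1613, 1619, 1621, 1627, 1637, 1657, 1663, 1667, 1669, 1693, 1697, 1699,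
        1709, 1721, 1723, 1733, 1741, 1747, 1753, 1759, 1777, 1783}
      (by simp only [Finset.forall_mem_insert, Finset.mem_singleton, forall_eq]; norm_num)
      (by decide) (by decide) h' (by omega)
  clear h; have h := h'; clear h'
  rcases le_or_gt 103 p with h' | h'
  · exact exists_primes_sum_sq_of_block (a := 103) (b := 366) (K := 5) (by norm_num) (by norm_num)
      {367, 373, 379, 383, 389, 397, 401, 409, 419, 421, 431, 433, 439, 443, 449, 457, 461, 463,
        467, 479, 487, 491, 499, 503, 509}
      (by simp only [Finset.forall_mem_insert, Finset.mem_singleton, forall_eq]; norm_num)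
      (by decide) (by decide) h' (by omega)
  clear h; have h := h'; clear h'
  rcases le_or_gt 47 p with h' | h'
  · exact exists_primes_sum_sq_of_block (a := 47) (b := 102) (K := 5) (by norm_num) (by norm_num)
      {103, 107, 109, 113, 127, 131, 137, 139, 149, 151, 157, 163, 167, 173, 179, 181, 191, 193,
        197, 199, 211, 223, 227, 229, 233}
      (by simp only [Finset.forall_mem_insert, Finset.mem_singleton, forall_eq]; norm_num)
      (by decide) (by decide) h' (by omega)
  clear h; have h := h'; clear h'
  rcases le_or_gt 29 p with h' | h'
  · exact exists_primes_sum_sq_of_block (a := 29) (b := 46) (K := 4) (by norm_num) (by norm_num)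
      {47, 53, 59, 61, 67, 71, 73, 79, 83, 89, 97, 101, 103, 107, 109, 113}
      (by simp only [Finset.forall_mem_insert, Finset.mem_singleton, forall_eq]; norm_num)
      (by decide) (by decide) h' (by omega)
  clear h; have h := h'; clear h'
  rcases le_or_gt 23 p with h' | h'
  · exact exists_primes_sum_sq_of_block (a := 23) (b := 28) (K := 3) (by norm_num) (by norm_num)
      {29, 31, 37, 41, 43, 47, 53, 59, 61}
      (by simp only [Finset.forall_mem_insert, Finset.mem_singleton, forall_eq]; norm_num)
      (by decide) (by decide) h' (by omega)
  clear h; have h := h'; clear h'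
  interval_cases p
  · exact ⟨{7, 11, 13, 17, 19}, by
      simp only [Finset.forall_mem_insert, Finset.mem_singleton, forall_eq]; norm_num, by
      norm_num [Finset.sum_insert]⟩
  · norm_num at hp
  · exact ⟨{11, 13, 17, 19}, by
      simp only [Finset.forall_mem_insert, Finset.mem_singleton, forall_eq]; norm_num, by
      norm_num [Finset.sum_insert]⟩
  · norm_num at hp
  · norm_num at hp
  · norm_num at hp
  · exact ⟨{13, 17}, by
      simp only [Finset.forall_mem_insert, Finset.mem_singleton, forall_eq]; norm_num, by
      norm_num [Finset.sum_insert]⟩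
  · norm_num at hp
  · exact ⟨{17, 19}, by
      simp only [Finset.forall_mem_insert, Finset.mem_singleton, forall_eq]; norm_num, by
      norm_num [Finset.sum_insert]⟩
  · norm_num at hp
  · norm_num at hp
  · norm_num at hp
  · exact ⟨{19, 23}, by
      simp only [Finset.forall_mem_insert, Finset.mem_singleton, forall_eq]; norm_num, by
      norm_num [Finset.sum_insert]⟩
  · norm_num at hp
  · exact ⟨{23, 29}, by
      simp only [Finset.forall_mem_insert, Finset.mem_singleton, forall_eq]; norm_num, by
      norm_num [Finset.sum_insert]⟩
  · norm_num at hp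
  · norm_num at hp
  · norm_num at hp

/-! ### Multiplicativity, Euler factors and tail products -/

/-- `σ_{-r}` as a function on all natural numbers. -/
noncomputable def sigmaN (r : ℝ) (n : ℕ) : ℝ := ∑ d ∈ n.divisors, (d : ℝ) ^ (-r)

theorem sigmaNeg_eq_sigmaN (r : ℝ) (n : ℕ+) : sigmaNeg r n = sigmaN r n := rfl

@[simp] theorem sigmaN_one (r : ℝ) : sigmaN r 1 = 1 := by simp [sigmaN]

theorem sigmaN_mul (r : ℝ) {m n : ℕ} (h : m.Coprime n) :
    sigmaN r (m * n) = sigmaN r m * sigmaN r n := by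
  let g : ArithmeticFunction ℝ := ⟨fun n ↦ if n = 0 then 0 else (n : ℝ) ^ (-r), by simp⟩
  have hg : ∀ n, n ≠ 0 → g n = (n : ℝ) ^ (-r) := fun n hn ↦ if_neg hn
  have hgm : g.IsMultiplicative := by
    rw [ArithmeticFunction.IsMultiplicative.iff_ne_zero]
    refine ⟨by rw [hg 1 one_ne_zero]; simp, fun {m n} hm hn _ ↦ ?_⟩
    rw [hg _ hm, hg _ hn, hg _ (mul_ne_zero hm hn), Nat.cast_mul,
      Real.mul_rpow (Nat.cast_nonneg _) (Nat.cast_nonneg _)]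
  have hs : ∀ n, sigmaN r n = (g * (ArithmeticFunction.zeta : ArithmeticFunction ℝ)) n := by
    intro n
    rw [ArithmeticFunction.coe_mul_zeta_apply]
    exact Finset.sum_congr rfl fun d hd ↦ (hg d (Nat.pos_of_mem_divisors hd).ne').symm
  rw [hs, hs, hs]
  exact (hgm.mul ArithmeticFunction.isMultiplicative_zeta.natCast).map_mul_of_coprime h

theorem sigmaN_prime_pow (r : ℝ) {p : ℕ} (hp : p.Prime) (k : ℕ) :
    sigmaN r (p ^ k) = ∑ i ∈ Finset.range (k + 1), ((p : ℝ) ^ (-r)) ^ i := by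
  rw [sigmaN, Nat.sum_divisors_prime_pow hp]
  refine Finset.sum_congr rfl fun i _ ↦ ?_
  rw [Nat.cast_pow, ← Real.rpow_natCast, ← Real.rpow_natCast, ← Real.rpow_mul (by positivity),
    ← Real.rpow_mul (by positivity), mul_comm]

theorem sigmaN_prime (r : ℝ) {p : ℕ} (hp : p.Prime) : sigmaN r p = 1 + (p : ℝ) ^ (-r) := by
  have := sigmaN_prime_pow r hp 1
  rw [pow_one] at this
  rw [this]; simp [Finset.sum_range_succ]

theorem sigmaN_mono_dvd (r : ℝ) {m n : ℕ} (hn : n ≠ 0) (h : m ∣ n) :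
    sigmaN r m ≤ sigmaN r n :=
  Finset.sum_le_sum_of_subset_of_nonneg (Nat.divisors_subset_of_dvd hn h)
    fun _ _ _ ↦ by positivity

theorem one_le_sigmaN (r : ℝ) {n : ℕ} (hn : n ≠ 0) : 1 ≤ sigmaN r n := by
  simpa using sigmaN_mono_dvd r hn (one_dvd n)

theorem rpow_neg_lt_one {r : ℝ} (hr : 0 < r) {p : ℕ} (hp : 1 < p) : (p : ℝ) ^ (-r) < 1 :=
  Real.rpow_lt_one_of_one_lt_of_neg (by exact_mod_cast hp) (by linarith)

theorem rpow_neg_le_half {r : ℝ} (hr : 1 ≤ r) {p : ℕ} (hp : 1 < p) : (p : ℝ) ^ (-r) ≤ 1 / 2 := by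
  have hp' : (2 : ℝ) ≤ p := by exact_mod_cast hp
  calc (p : ℝ) ^ (-r) ≤ (p : ℝ) ^ (-1 : ℝ) :=
        Real.rpow_le_rpow_of_exponent_le (by linarith) (by linarith)
    _ = (p : ℝ)⁻¹ := Real.rpow_neg_one _
    _ ≤ 1 / 2 := by rw [one_div]; gcongr

/-- The Euler factor `1 / (1 - q^{-r})`. -/
noncomputable def eulerFactor (r : ℝ) (q : ℕ) : ℝ := 1 / (1 - (q : ℝ) ^ (-r))

theorem one_add_le_eulerFactor {r : ℝ} (hr : 0 < r) {q : ℕ} (hq : q.Prime) :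
    1 + (q : ℝ) ^ (-r) ≤ eulerFactor r q := by
  have h := rpow_neg_lt_one hr hq.one_lt
  have h0 : 0 ≤ (q : ℝ) ^ (-r) := by positivity
  rw [eulerFactor, le_div_iff₀ (by linarith)]
  nlinarith

theorem one_le_eulerFactor {r : ℝ} (hr : 0 < r) {q : ℕ} (hq : q.Prime) : 1 ≤ eulerFactor r q :=
  le_trans (le_add_of_nonneg_right (by positivity)) (one_add_le_eulerFactor hr hq)

theorem sigmaN_prime_pow_tendsto {r : ℝ} (hr : 0 < r) {q : ℕ} (hq : q.Prime) :
    Filter.Tendsto (fun k ↦ sigmaN r (q ^ k)) Filter.atTop (nhds (eulerFactor r q)) := by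
  have h := hasSum_geometric_of_lt_one (by positivity) (rpow_neg_lt_one hr hq.one_lt)
  have := (h.tendsto_sum_nat).comp (Filter.tendsto_add_atTop_nat 1)
  rw [eulerFactor, one_div]
  exact this.congr fun k ↦ (sigmaN_prime_pow r hq k).symm

theorem sigmaN_prime_pow_le {r : ℝ} (hr : 0 < r) {q : ℕ} (hq : q.Prime) (k : ℕ) :
    sigmaN r (q ^ k) ≤ eulerFactor r q := by
  refine Monotone.ge_of_tendsto (monotone_nat_of_le_succ fun n ↦ ?_)
    (sigmaN_prime_pow_tendsto hr hq) k
  exact sigmaN_mono_dvd r (pow_ne_zero _ hq.ne_zero) (pow_dvd_pow q n.le_succ)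

theorem sigmaN_prime_pow_succ_le {r : ℝ} {q : ℕ} (hq : q.Prime) (k : ℕ) :
    sigmaN r (q ^ (k + 1)) ≤ sigmaN r (q ^ k) * (1 + ((q : ℝ) ^ (-r)) ^ (k + 1)) := by
  have h1 := one_le_sigmaN r (n := q ^ k) (pow_ne_zero _ hq.ne_zero)
  have h2 : 0 ≤ ((q : ℝ) ^ (-r)) ^ (k + 1) := by positivity
  have : sigmaN r (q ^ (k + 1)) = sigmaN r (q ^ k) + ((q : ℝ) ^ (-r)) ^ (k + 1) := by
    rw [sigmaN_prime_pow r hq, sigmaN_prime_pow r hq, Finset.sum_range_succ]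
  rw [this]
  nlinarith

/-- The product of the Euler factors over the primes `q > p`. -/
noncomputable def tailProd (r : ℝ) (p : ℕ) : ENNReal :=
  ∏' q : {q : ℕ // q.Prime ∧ p < q}, ENNReal.ofReal (1 / (1 - ((q : ℕ) : ℝ) ^ (-r)))

/-- All factors are at least 1, so the finite products increase to the infinite one, whether or not
it converges. -/
theorem tailProd_eq_iSup {r : ℝ} (hr : 0 < r) (p : ℕ) :
    tailProd r p = ⨆ F : Finset {q : ℕ // q.Prime ∧ p < q},
      ENNReal.ofReal (∏ q ∈ F, eulerFactor r q) := by
  have h : HasProd (fun q : {q : ℕ // q.Prime ∧ p < q} ↦ ENNReal.ofReal (eulerFactor r q))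
      (⨆ F : Finset {q : ℕ // q.Prime ∧ p < q}, ∏ q ∈ F, ENNReal.ofReal (eulerFactor r q)) :=
    hasProd_of_isLUB_of_one_le _
      (fun q ↦ ENNReal.one_le_ofReal.2 (one_le_eulerFactor hr q.2.1)) isLUB_iSup
  rw [tailProd]
  refine h.tprod_eq.trans (iSup_congr fun F ↦ ?_)
  rw [ENNReal.ofReal_prod_of_nonneg]
  exact fun q _ ↦ zero_le_one.trans (one_le_eulerFactor hr q.2.1)

theorem prod_le_tailProd {r : ℝ} (hr : 0 < r) {p : ℕ} (F : Finset ℕ)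
    (hF : ∀ q ∈ F, q.Prime ∧ p < q) :
    ENNReal.ofReal (∏ q ∈ F, eulerFactor r q) ≤ tailProd r p := by
  rw [tailProd_eq_iSup hr]
  refine le_trans (le_of_eq ?_) (le_iSup _ (F.subtype fun q ↦ q.Prime ∧ p < q))
  congr 1
  rw [Finset.prod_subtype_of_mem _ hF]

theorem tailProd_le {r : ℝ} (hr : 0 < r) {p : ℕ} {c : ENNReal}
    (h : ∀ F : Finset ℕ, (∀ q ∈ F, q.Prime ∧ p < q) →
      ENNReal.ofReal (∏ q ∈ F, eulerFactor r q) ≤ c) : tailProd r p ≤ c := by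
  rw [tailProd_eq_iSup hr]
  refine iSup_le fun F ↦ ?_
  have := h (F.map (Function.Embedding.subtype _)) (by
    intro q hq
    simp only [Finset.mem_map] at hq
    obtain ⟨x, -, rfl⟩ := hq
    exact x.2)
  simpa using this

/-- All prime factors of `n` exceed `p`. -/
def Rough (p n : ℕ) : Prop := n ≠ 0 ∧ ∀ q : ℕ, q.Prime → q ∣ n → p < q

theorem rough_one (p : ℕ) : Rough p 1 :=
  ⟨one_ne_zero, fun _ hq h ↦ absurd (Nat.dvd_one.1 h) hq.ne_one⟩

theorem Rough.mul {p m n : ℕ} (hm : Rough p m) (hn : Rough p n) : Rough p (m * n) :=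
  ⟨mul_ne_zero hm.1 hn.1, fun q hq h ↦ (hq.dvd_mul.1 h).elim (hm.2 q hq) (hn.2 q hq)⟩

theorem Rough.mono {p p' n : ℕ} (h : Rough p n) (hp : p' ≤ p) : Rough p' n :=
  ⟨h.1, fun q hq hd ↦ hp.trans_lt (h.2 q hq hd)⟩

theorem rough_prime_pow {p q : ℕ} (hq : q.Prime) (h : p < q) (k : ℕ) : Rough p (q ^ k) :=
  ⟨pow_ne_zero _ hq.ne_zero, fun q' hq' hd ↦ by
    rwa [(Nat.prime_dvd_prime_iff_eq hq' hq).1 (hq'.dvd_of_dvd_pow hd)]⟩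

theorem Rough.coprime_pow {p n q : ℕ} (h : Rough p n) (hq : q.Prime) (hqp : q ≤ p) (k : ℕ) :
    (q ^ k).Coprime n :=
  Nat.Coprime.pow_left _ ((Nat.Prime.coprime_iff_not_dvd hq).2 fun hd ↦
    absurd (h.2 q hq hd) (by omega))

theorem sigmaN_le_tailProd {r : ℝ} (hr : 0 < r) {p n : ℕ} (h : Rough p n) :
    ENNReal.ofReal (sigmaN r n) ≤ tailProd r p := by
  refine le_trans (ENNReal.ofReal_le_ofReal ?_) (prod_le_tailProd hr n.primeFactors
    fun q hq ↦ ⟨Nat.prime_of_mem_primeFactors hq,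
      h.2 q (Nat.prime_of_mem_primeFactors hq) (Nat.dvd_of_mem_primeFactors hq)⟩)
  rw [Nat.multiplicative_factorization (sigmaN r) (fun _ _ ↦ sigmaN_mul r) (sigmaN_one r) h.1,
    Finsupp.prod, Nat.support_factorization]
  refine Finset.prod_le_prod (fun q hq ↦ ?_) fun q hq ↦
    sigmaN_prime_pow_le hr (Nat.prime_of_mem_primeFactors hq) _
  exact zero_le_one.trans
    (one_le_sigmaN r (pow_ne_zero _ (Nat.prime_of_mem_primeFactors hq).ne_zero))

theorem coprime_prod_pow {F : Finset ℕ} (hF : ∀ q ∈ F, q.Prime) {q : ℕ} (hq : q.Prime)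
    (hqF : q ∉ F) (k l : ℕ) : (q ^ l).Coprime (∏ q ∈ F, q ^ k) :=
  Nat.Coprime.prod_right fun q' hq' ↦ Nat.Coprime.pow _ _
    ((Nat.coprime_primes hq (hF q' hq')).2 fun h ↦ hqF (h ▸ hq'))

theorem sigmaN_prod_pow (r : ℝ) (F : Finset ℕ) (hF : ∀ q ∈ F, q.Prime) (k : ℕ) :
    sigmaN r (∏ q ∈ F, q ^ k) = ∏ q ∈ F, sigmaN r (q ^ k) := by
  induction F using Finset.induction_on with
  | empty => simp
  | insert q F hq ih =>
    have hF' : ∀ q ∈ F, q.Prime := fun x hx ↦ hF x (Finset.mem_insert_of_mem hx)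
    rw [Finset.prod_insert hq, Finset.prod_insert hq, sigmaN_mul, ih hF']
    exact coprime_prod_pow hF' (hF q (Finset.mem_insert_self _ _)) hq k k

theorem rough_prod_pow {p : ℕ} (F : Finset ℕ) (hF : ∀ q ∈ F, q.Prime ∧ p < q) (k : ℕ) :
    Rough p (∏ q ∈ F, q ^ k) :=
  Finset.prod_induction _ (Rough p) (fun _ _ ↦ Rough.mul) (rough_one p)
    fun q hq ↦ rough_prime_pow (hF q hq).1 (hF q hq).2 k

/-- The tail product is a supremum of finite Euler products, and each of these is the limit of `σ(∏
q^k)` as `k` grows. -/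
theorem exists_rough_lt_sigmaN {r : ℝ} (hr : 0 < r) {p : ℕ} {t : ℝ}
    (ht : ENNReal.ofReal t < tailProd r p) : ∃ n, Rough p n ∧ t < sigmaN r n := by
  by_contra! hcon
  refine ht.not_ge (tailProd_le hr fun F hF ↦ ENNReal.ofReal_le_ofReal ?_)
  have h1 : Filter.Tendsto (fun k ↦ ∏ q ∈ F, sigmaN r (q ^ k)) Filter.atTop
      (nhds (∏ q ∈ F, eulerFactor r q)) :=
    tendsto_finsetProd _ fun q hq ↦ sigmaN_prime_pow_tendsto hr (hF q hq).1
  refine le_of_tendsto' h1 fun k ↦ ?_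
  rw [← sigmaN_prod_pow r F fun q hq ↦ (hF q hq).1]
  exact hcon _ (rough_prod_pow F hF k)

theorem rpow_neg_eq_mul_div_rpow (r : ℝ) {p n : ℕ} (hp : 0 < p) :
    (n : ℝ) ^ (-r) = (p : ℝ) ^ (-r) * ((p : ℝ) / n) ^ r := by
  have hp' : (0 : ℝ) < p := by exact_mod_cast hp
  rw [Real.div_rpow hp'.le (Nat.cast_nonneg n), Real.rpow_neg hp'.le,
    Real.rpow_neg (Nat.cast_nonneg n)]
  have := (Real.rpow_pos_of_pos hp' r).ne'
  field_simp

/-! ### Which primes are mighty -/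

theorem tailProd_ge_of_not_isMighty {r : ℝ} {p : ℕ} (hp : p.Prime) (h : ¬ IsMighty r p) :
    ENNReal.ofReal (1 + (p : ℝ) ^ (-r)) ≤ tailProd r p :=
  not_lt.1 fun h' ↦ h ⟨hp, h'⟩

theorem one_add_sum_le_prod_one_add {ι : Type*} (F : Finset ι) {f : ι → ℝ}
    (hf : ∀ i ∈ F, 0 ≤ f i) : 1 + ∑ i ∈ F, f i ≤ ∏ i ∈ F, (1 + f i) := by
  classical
  induction F using Finset.induction_on with
  | empty => simp
  | insert i F hi ih =>
    rw [Finset.sum_insert hi, Finset.prod_insert hi]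
    have h1 := ih fun j hj ↦ hf j (Finset.mem_insert_of_mem hj)
    have h2 := hf i (Finset.mem_insert_self i F)
    have h3 : 0 ≤ ∑ i ∈ F, f i :=
      Finset.sum_nonneg fun j hj ↦ hf j (Finset.mem_insert_of_mem hj)
    nlinarith

/-- For `q > p` and `r ≤ 2`, `(p / q)^r ≥ (p / q)²`. Hence the larger primes of
`exists_primes_sum_sq` have `∑ q^{-r} ≥ p^{-r}`, and their Euler factors alone multiply to at least
`1 + p^{-r}`. -/
theorem not_isMighty_of_le_two {r : ℝ} (hr : 0 < r) (hr2 : r ≤ 2) {p : ℕ} (h5 : 5 ≤ p) :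
    ¬ IsMighty r p := by
  rintro ⟨hp, hm⟩
  obtain ⟨F, hF, hsum⟩ := exists_primes_sum_sq hp h5
  refine hm.not_ge (le_trans (ENNReal.ofReal_le_ofReal ?_) (prod_le_tailProd hr F hF))
  have h1 : ∏ q ∈ F, (1 + (q : ℝ) ^ (-r)) ≤ ∏ q ∈ F, eulerFactor r q :=
    Finset.prod_le_prod (fun _ _ ↦ by positivity) fun q hq ↦ one_add_le_eulerFactor hr (hF q hq).1
  have h2 : 1 + ∑ q ∈ F, (q : ℝ) ^ (-r) ≤ ∏ q ∈ F, (1 + (q : ℝ) ^ (-r)) :=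
    one_add_sum_le_prod_one_add F fun _ _ ↦ by positivity
  have h3 : (p : ℝ) ^ (-r) * ∑ q ∈ F, ((p : ℝ) / q) ^ 2 ≤ ∑ q ∈ F, (q : ℝ) ^ (-r) := by
    rw [Finset.mul_sum]
    refine Finset.sum_le_sum fun q hq ↦ ?_
    have hp0 : (0 : ℝ) < p := by exact_mod_cast hp.pos
    have hq0 : (p : ℝ) < q := by exact_mod_cast (hF q hq).2
    rw [rpow_neg_eq_mul_div_rpow r (n := q) hp.pos, ← Real.rpow_natCast]
    refine mul_le_mul_of_nonneg_left ?_ (by positivity)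
    refine Real.rpow_le_rpow_of_exponent_ge (div_pos hp0 (hp0.trans hq0)) ?_ (by simpa using hr2)
    rw [div_le_one (hp0.trans hq0)]; exact hq0.le
  have h4 : 0 ≤ (p : ℝ) ^ (-r) := by positivity
  nlinarith

/-- `n ↦ n^{-r}` restricted to the integers coprime to `M`. -/
noncomputable def coprimeRpow (r : ℝ) (hr : 0 < r) (M : ℕ) : ℕ →*₀ ℝ where
  toFun n := if n.Coprime M then (n : ℝ) ^ (-r) else 0
  map_zero' := by simp [Real.zero_rpow (neg_ne_zero.2 hr.ne')]
  map_one' := by simp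
  map_mul' m n := by
    simp only [Nat.coprime_mul_iff_left, Nat.cast_mul,
      Real.mul_rpow (Nat.cast_nonneg m) (Nat.cast_nonneg n)]
    split_ifs <;> simp_all

theorem coprimeRpow_apply {r : ℝ} (hr : 0 < r) (M n : ℕ) :
    coprimeRpow r hr M n = if n.Coprime M then (n : ℝ) ^ (-r) else 0 := rfl

theorem coprimeRpow_nonneg {r : ℝ} (hr : 0 < r) (M n : ℕ) : 0 ≤ coprimeRpow r hr M n := by
  rw [coprimeRpow_apply]; split_ifs <;> positivity

theorem summable_coprimeRpow {r : ℝ} (hr : 1 < r) (M : ℕ) :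
    Summable (coprimeRpow r (zero_lt_one.trans hr) M) := by
  refine Summable.of_nonneg_of_le (coprimeRpow_nonneg _ M) (fun n ↦ ?_)
    (Real.summable_nat_rpow.2 (neg_lt_neg hr))
  rw [coprimeRpow_apply]
  split_ifs
  · exact le_rfl
  · positivity

/-- The sum equals the Euler product over all primes not dividing `M`, which include every prime
above `p`. -/
theorem tailProd_le_tsum {r : ℝ} (hr : 1 < r) {p M : ℕ}
    (hM : ∀ q : ℕ, q.Prime → p < q → q.Coprime M) :
    tailProd r p ≤ ENNReal.ofReal (∑' n, coprimeRpow r (zero_lt_one.trans hr) M n) := by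
  have hr0 := zero_lt_one.trans hr
  set f := coprimeRpow r hr0 M with hf
  have hprod : HasProd (fun q : Nat.Primes ↦ (1 - f q)⁻¹) (∑' n, f n) :=
    EulerProduct.eulerProduct_completely_multiplicative_hasProd (summable_coprimeRpow hr M).norm
  have hle : ∀ q : Nat.Primes, 1 ≤ (1 - f q)⁻¹ := by
    intro q
    have h1 : f q < 1 := by
      rw [hf, coprimeRpow_apply]
      split_ifs
      · exact rpow_neg_lt_one hr0 q.2.one_lt
      · exact zero_lt_one
    have h0 := coprimeRpow_nonneg hr0 M q
    rw [one_le_inv₀ (by linarith)]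
    linarith
  refine tailProd_le hr0 fun F hF ↦ ENNReal.ofReal_le_ofReal ?_
  have h : ∏ q ∈ F.subtype Nat.Prime, (1 - f ((q : Nat.Primes) : ℕ))⁻¹ ≤ ∑' n, f n := by
    refine ge_of_tendsto hprod (Filter.eventually_atTop.2 ⟨F.subtype Nat.Prime, fun G hG ↦ ?_⟩)
    exact Finset.prod_le_prod_of_subset_of_one_le hG
      (fun q _ ↦ zero_le_one.trans (hle q)) fun q _ _ ↦ hle q
  refine le_trans (le_of_eq ?_) h
  rw [Finset.prod_subtype_of_mem (fun q ↦ (1 - f q)⁻¹) fun q hq ↦ (hF q hq).1]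
  refine Finset.prod_congr rfl fun q hq ↦ ?_
  rw [hf, coprimeRpow_apply, if_pos (hM q (hF q hq).1 (hF q hq).2), eulerFactor, one_div]

/-- The terms at multiples of `q` sum to `q^{-r}` times the whole series. Starting from `ζ(2)`, this
removes the primes 2, 3 and 5 in turn. -/
theorem tsum_coprimeRpow_mul {r : ℝ} (hr : 1 < r) {M q : ℕ} (hq : q.Prime) (hqM : q.Coprime M) :
    ∑' n, coprimeRpow r (zero_lt_one.trans hr) (M * q) n =
      (1 - (q : ℝ) ^ (-r)) * ∑' n, coprimeRpow r (zero_lt_one.trans hr) M n := by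
  have hr0 := zero_lt_one.trans hr
  set f := coprimeRpow r hr0 M with hf
  have hfs : Summable f := summable_coprimeRpow hr M
  have h1 : ∀ n, coprimeRpow r hr0 (M * q) n = f n - {n | q ∣ n}.indicator f n := by
    intro n
    have hqn : n.Coprime q ↔ ¬ q ∣ n := by rw [Nat.coprime_comm, hq.coprime_iff_not_dvd]
    by_cases h : q ∣ n
    · rw [Set.indicator_of_mem (by exact h), sub_self, coprimeRpow_apply, if_neg]
      rw [Nat.coprime_mul_iff_right, hqn]; tauto
    · rw [Set.indicator_of_notMem (by exact h), sub_zero, hf, coprimeRpow_apply, coprimeRpow_apply,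
        if_congr (Nat.coprime_mul_iff_right.trans (and_iff_left (hqn.2 h))) rfl rfl]
  have h2 : ∑' n, {n | q ∣ n}.indicator f n = (q : ℝ) ^ (-r) * ∑' n, f n := by
    rw [← (mul_right_injective₀ hq.ne_zero).tsum_eq (f := {n | q ∣ n}.indicator f),
      ← tsum_mul_left]
    · refine tsum_congr fun n ↦ ?_
      rw [Set.indicator_of_mem (by exact dvd_mul_right q n), map_mul]
      congr 1
      rw [hf, coprimeRpow_apply, if_pos hqM]
    · intro n hn
      obtain ⟨m, rfl⟩ := Set.mem_of_indicator_ne_zero hn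
      exact ⟨m, rfl⟩
  rw [tsum_congr h1, hfs.tsum_sub (hfs.indicator _), h2]
  ring

theorem tsum_coprimeRpow_two_one :
    ∑' n, coprimeRpow 2 two_pos 1 n = Real.pi ^ 2 / 6 := by
  rw [← hasSum_zeta_two.tsum_eq]
  refine tsum_congr fun n ↦ ?_
  rw [coprimeRpow_apply, if_pos (Nat.coprime_one_right n), Real.rpow_neg (Nat.cast_nonneg n),
    one_div]
  norm_cast

theorem tsum_coprimeRpow_two_two :
    ∑' n, coprimeRpow 2 two_pos 2 n = Real.pi ^ 2 / 8 := by
  have h := tsum_coprimeRpow_mul one_lt_two (M := 1) Nat.prime_two (by norm_num)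
  rw [tsum_coprimeRpow_two_one] at h
  norm_num at h
  linarith

theorem tsum_coprimeRpow_two_six :
    ∑' n, coprimeRpow 2 two_pos 6 n = Real.pi ^ 2 / 9 := by
  have h := tsum_coprimeRpow_mul one_lt_two (M := 2) Nat.prime_three (by norm_num)
  rw [tsum_coprimeRpow_two_two] at h
  norm_num at h
  linarith

theorem tsum_coprimeRpow_two_thirty :
    ∑' n, coprimeRpow 2 two_pos 30 n = Real.pi ^ 2 * (8 / 75) := by
  have h := tsum_coprimeRpow_mul one_lt_two (M := 6) Nat.prime_five (by norm_num)
  rw [tsum_coprimeRpow_two_six] at h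
  norm_num at h
  linarith

/-- For `n > p`, `n^{-r} = p^{-r} (p / n)^r ≤ p^{-r} (p / n)²`, so the condition at exponent 2
transfers to every `r ≥ 2`. It holds for 2 and 3, as `4 (π²/8 - 1)` and `9 (π²/9 - 1)` are below 1.
-/
theorem isMighty_of_two_le {r : ℝ} (hr : 2 ≤ r) {p M : ℕ} (hp : p.Prime)
    (hM : ∀ q : ℕ, q.Prime → p < q → q.Coprime M)
    (hpM : ∀ n : ℕ, 1 < n → n.Coprime M → p < n)
    (hs : (p : ℝ) ^ 2 * (∑' n, coprimeRpow 2 two_pos M n - 1) < 1) : IsMighty r p := by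
  have hr1 : 1 < r := by linarith
  refine ⟨hp, (tailProd_le_tsum hr1 hM).trans_lt ?_⟩
  rw [ENNReal.ofReal_lt_ofReal_iff (by positivity)]
  set c : ℝ := (p : ℝ) ^ (-r) * (p : ℝ) ^ 2 with hc
  have hp0 : (0 : ℝ) < p := by exact_mod_cast hp.pos
  have hc0 : 0 ≤ c := by positivity
  -- The majorant is `c n^{-2}`, except that its term at `n = 1` is corrected to 1.
  have hg : HasSum (fun n ↦ c * coprimeRpow 2 two_pos M n + if n = 1 then 1 - c else 0)
      (c * ∑' n, coprimeRpow 2 two_pos M n + (1 - c)) :=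
    ((summable_coprimeRpow one_lt_two M).hasSum.mul_left c).add (hasSum_ite_eq 1 (1 - c))
  have hle : ∑' n, coprimeRpow r (zero_lt_one.trans hr1) M n ≤
      c * ∑' n, coprimeRpow 2 two_pos M n + (1 - c) := by
    rw [← hg.tsum_eq]
    refine (summable_coprimeRpow hr1 M).tsum_le_tsum (fun n ↦ ?_) hg.summable
    rw [coprimeRpow_apply, coprimeRpow_apply]
    by_cases hn : n.Coprime M
    · rw [if_pos hn, if_pos hn]
      rcases Nat.lt_trichotomy n 1 with h | rfl | h
      · obtain rfl : n = 0 := by omega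
        simp [Real.zero_rpow (show -r ≠ 0 by linarith)]
      · simp
      · have hpn : (p : ℝ) < n := by exact_mod_cast hpM n h hn
        rw [if_neg h.ne', add_zero, rpow_neg_eq_mul_div_rpow r hp.pos,
          rpow_neg_eq_mul_div_rpow 2 hp.pos, hc, mul_assoc]
        refine mul_le_mul_of_nonneg_left ?_ (by positivity)
        rw [← mul_assoc, Real.rpow_neg hp0.le, Real.rpow_two, mul_inv_cancel₀ (by positivity),
          one_mul]
        exact Real.rpow_le_rpow_of_exponent_ge (div_pos hp0 (hp0.trans hpn))
          ((div_le_one (hp0.trans hpn)).2 hpn.le) hr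
    · simp only [if_neg hn, mul_zero, zero_add]
      rw [if_neg]
      rintro rfl
      exact hn (Nat.coprime_one_left M)
  refine hle.trans_lt ?_
  have : 0 < (p : ℝ) ^ (-r) := by positivity
  have := mul_lt_mul_of_pos_left hs this
  rw [hc]; nlinarith

theorem isMighty_two {r : ℝ} (hr : 2 ≤ r) : IsMighty r 2 := by
  refine isMighty_of_two_le (M := 2) hr Nat.prime_two
    (fun q hq h ↦ (Nat.coprime_primes hq Nat.prime_two).2 h.ne') (fun n h1 h2 ↦ ?_) ?_
  · by_contra! h
    interval_cases n
    norm_num at h2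
  · rw [tsum_coprimeRpow_two_two]
    have := Real.pi_lt_d4
    have := Real.pi_pos
    push_cast
    nlinarith

theorem coprime_six_of_prime {q : ℕ} (hq : q.Prime) (h : 3 < q) : q.Coprime 6 := by
  rw [show 6 = 2 * 3 by norm_num, Nat.coprime_mul_iff_right,
    Nat.coprime_primes hq Nat.prime_two, Nat.coprime_primes hq Nat.prime_three]
  omega

theorem isMighty_three {r : ℝ} (hr : 2 ≤ r) : IsMighty r 3 := by
  refine isMighty_of_two_le (M := 6) hr Nat.prime_three
    (fun q hq h ↦ coprime_six_of_prime hq h) (fun n h1 h2 ↦ ?_) ?_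
  · by_contra! h
    interval_cases n <;> norm_num at h2
  · rw [tsum_coprimeRpow_two_six]
    have := Real.pi_lt_d4
    have := Real.pi_pos
    push_cast
    nlinarith

theorem div_rpow_le_of_five_halves_le {r : ℝ} (hr : 5 / 2 ≤ r) {m n : ℕ} (hm : 5 ≤ m)
    (hmn : m ≤ n) {c : ℝ} (hc : 0 ≤ c) (hc2 : 5 / m ≤ c ^ 2) :
    ((5 : ℝ) / n) ^ r ≤ ((5 : ℝ) / n) ^ 2 * c := by
  have hm0 : (5 : ℝ) ≤ m := by exact_mod_cast hm
  have hmn0 : (m : ℝ) ≤ n := by exact_mod_cast hmn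
  have h0 : (0 : ℝ) < 5 / n := by apply div_pos <;> linarith
  calc ((5 : ℝ) / n) ^ r ≤ ((5 : ℝ) / n) ^ ((2 : ℕ) + 1 / 2 : ℝ) := by
        refine Real.rpow_le_rpow_of_exponent_ge h0 ?_ (by push_cast; linarith)
        rw [div_le_one (by linarith)]; linarith
    _ = ((5 : ℝ) / n) ^ 2 * √(5 / n) := by
        rw [Real.rpow_add h0, Real.rpow_natCast, Real.sqrt_eq_rpow]
    _ ≤ ((5 : ℝ) / n) ^ 2 * c := by
        refine mul_le_mul_of_nonneg_left ?_ (by positivity)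
        rw [Real.sqrt_le_left hc]
        refine le_trans ?_ hc2
        gcongr

/-- At `r = 2` the criterion fails for 5, so the extra factor `(5 / n)^{1/2}` is needed. The
constants `0.8453` and `0.6744` bound `√(5/7)` and `√(5/11)` from above; 7 and 11 are the first
integers above 1 prime to 30. -/
theorem isMighty_five {r : ℝ} (hr : 5 / 2 ≤ r) : IsMighty r 5 := by
  have hr1 : 1 < r := by linarith
  have hM : ∀ q : ℕ, q.Prime → 5 < q → q.Coprime 30 := by
    intro q hq h
    rw [show 30 = 6 * 5 by norm_num, Nat.coprime_mul_iff_right]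
    exact ⟨coprime_six_of_prime hq (by omega), (Nat.coprime_primes hq Nat.prime_five).2 h.ne'⟩
  refine ⟨Nat.prime_five, (tailProd_le_tsum hr1 hM).trans_lt ?_⟩
  rw [ENNReal.ofReal_lt_ofReal_iff (by positivity)]
  set x : ℝ := ((5 : ℕ) : ℝ) ^ (-r) with hx
  have hx0 : 0 < x := by positivity
  -- The factor `0.6744` is used throughout; the two correction terms restore 1 at `n = 1` and the
  -- factor `0.8453` at `n = 7`.
  have hg : HasSum (fun n ↦ (x * 25 * 0.6744) * coprimeRpow 2 two_pos 30 n +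
      (if n = 1 then 1 - x * 25 * 0.6744 else 0) +
      (if n = 7 then x * (25 / 49) * (0.8453 - 0.6744) else 0))
      ((x * 25 * 0.6744) * ∑' n, coprimeRpow 2 two_pos 30 n + (1 - x * 25 * 0.6744) +
        x * (25 / 49) * (0.8453 - 0.6744)) :=
    (((summable_coprimeRpow one_lt_two 30).hasSum.mul_left _).add (hasSum_ite_eq 1 _)).add
      (hasSum_ite_eq 7 _)
  have hle : ∑' n, coprimeRpow r (zero_lt_one.trans hr1) 30 n ≤
      (x * 25 * 0.6744) * ∑' n, coprimeRpow 2 two_pos 30 n + (1 - x * 25 * 0.6744) +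
        x * (25 / 49) * (0.8453 - 0.6744) := by
    rw [← hg.tsum_eq]
    refine (summable_coprimeRpow hr1 30).tsum_le_tsum (fun n ↦ ?_) hg.summable
    rw [coprimeRpow_apply, coprimeRpow_apply]
    by_cases hn : n.Coprime 30
    · have h2 : (n : ℝ) ^ (-2 : ℝ) = 1 / (n : ℝ) ^ 2 := by
        rw [Real.rpow_neg (Nat.cast_nonneg n), Real.rpow_two, one_div]
      rw [if_pos hn, if_pos hn, h2]
      rcases Nat.lt_or_ge n 11 with h | h
      · have h17 : n = 1 ∨ n = 7 := by
          interval_cases n <;> norm_num at hn <;> simp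
        rcases h17 with rfl | rfl
        · simp
        · have := div_rpow_le_of_five_halves_le hr (m := 7) (n := 7) (c := 0.8453) (by norm_num)
            le_rfl (by norm_num) (by norm_num)
          have := mul_le_mul_of_nonneg_left this hx0.le
          rw [rpow_neg_eq_mul_div_rpow r (p := 5) (by norm_num), ← hx]
          norm_num at this ⊢
          linarith
      · have := div_rpow_le_of_five_halves_le hr (m := 11) (n := n) (c := 0.6744) (by norm_num)
            h (by norm_num) (by norm_num)
        have := mul_le_mul_of_nonneg_left this hx0.le
        rw [rpow_neg_eq_mul_div_rpow r (p := 5) (by norm_num), ← hx, if_neg (by omega),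
          if_neg (by omega), add_zero, add_zero]
        refine this.trans (le_of_eq ?_)
        ring
    · simp only [if_neg hn, mul_zero, zero_add]
      rw [if_neg, if_neg, zero_add] <;> rintro rfl <;> norm_num at hn
  refine hle.trans_lt ?_
  rw [tsum_coprimeRpow_two_thirty]
  have h1 := Real.pi_lt_d4
  have h2 : Real.pi ^ 2 < 3.1416 ^ 2 := by gcongr
  have := mul_lt_mul_of_pos_left h2 hx0
  norm_num at this ⊢
  linarith

/-! ### Counting components; five of them from a mighty prime above 3 -/

/-- A component is order connected in `ℝ`, so it cannot contain points on both sides of a missing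
value. -/
theorem succ_le_card_connectedComponents {S : Set ℝ} {n : ℕ} (x : Fin (n + 1) → ℝ)
    (hx : ∀ i, x i ∈ S) (hg : ∀ i : Fin n, ∃ g ∉ S, x i.castSucc < g ∧ g < x i.succ) :
    ((n + 1 : ℕ) : ℕ∞) ≤ ENat.card (ConnectedComponents S) := by
  have hmono : StrictMono x := Fin.strictMono_iff_lt_succ.2 fun i ↦ by
    obtain ⟨g, -, h1, h2⟩ := hg i
    exact h1.trans h2
  have hne : ∀ i j, i < j →
      (ConnectedComponents.mk (⟨x i, hx i⟩ : S)) ≠ ConnectedComponents.mk ⟨x j, hx j⟩ := by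
    intro i j hij h
    have hij' : (i : ℕ) < j := hij
    have hin : (i : ℕ) < n := by omega
    obtain ⟨g, hgS, h1, h2⟩ := hg ⟨i, hin⟩
    have hi : (⟨i, hin⟩ : Fin n).castSucc = i := rfl
    have hj : x (⟨i, hin⟩ : Fin n).succ ≤ x j := hmono.monotone (by
      rw [Fin.le_def]; simpa using hij')
    rw [hi] at h1
    have hconn := (isPreconnected_connectedComponent (x := (⟨x i, hx i⟩ : S))).image Subtype.val
      continuous_subtype_val.continuousOn
    have hmi : x i ∈ Subtype.val '' connectedComponent (⟨x i, hx i⟩ : S) :=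
      ⟨_, mem_connectedComponent, rfl⟩
    have hmj : x j ∈ Subtype.val '' connectedComponent (⟨x i, hx i⟩ : S) := by
      refine ⟨⟨x j, hx j⟩, ?_, rfl⟩
      rw [ConnectedComponents.coe_eq_coe.1 h]
      exact mem_connectedComponent
    obtain ⟨y, -, hy⟩ := hconn.ordConnected.out hmi hmj ⟨h1.le, h2.le.trans hj⟩
    exact hgS (hy ▸ y.2)
  have hinj : Function.Injective fun i ↦ ConnectedComponents.mk (⟨x i, hx i⟩ : S) := by
    intro i j h
    rcases lt_trichotomy i j with hij | hij | hij
    · exact absurd h (hne i j hij)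
    · exact hij
    · exact absurd h.symm (hne j i hij)
  simpa using ENat.card_le_card_of_injective hinj

theorem card_connectedComponents_le {X : Type*} [TopologicalSpace X] {S : Set X} {n : ℕ}
    (V : Fin n → Set X) (hV : ∀ i, IsPreconnected (V i)) (hVS : ∀ i, V i ⊆ S)
    (hSV : ∀ x ∈ S, ∃ i, x ∈ V i) :
    ENat.card (ConnectedComponents S) ≤ n := by
  choose k hk using fun y : S ↦ hSV y y.2
  have hinj : Function.Injective fun c : ConnectedComponents S ↦ k (Quot.out c) := by
    intro c d h
    have hp : IsPreconnected (Subtype.val ⁻¹' V (k (Quot.out c)) : Set S) := by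
      refine (Topology.IsInducing.subtypeVal.isPreconnected_image).1 ?_
      rw [Subtype.image_preimage_coe, Set.inter_eq_self_of_subset_right]
      · exact hV _
      · exact hVS _
    have hc : Quot.out c ∈ (Subtype.val ⁻¹' V (k (Quot.out c)) : Set S) := hk _
    have hd : Quot.out d ∈ (Subtype.val ⁻¹' V (k (Quot.out c)) : Set S) := by
      simp only at h
      rw [h]; exact hk _
    have := connectedComponent_eq (hp.subset_connectedComponent hc hd)
    rw [← ConnectedComponents.coe_eq_coe] at this
    have hout : ∀ e : ConnectedComponents S, ConnectedComponents.mk (Quot.out e) = e :=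
      fun e ↦ Quot.out_eq e
    rwa [hout, hout] at this
  simpa using ENat.card_le_card_of_injective hinj

theorem sigmaN_mem_range (r : ℝ) {n : ℕ} (hn : n ≠ 0) :
    sigmaN r n ∈ Set.range (sigmaNeg r) :=
  ⟨⟨n, Nat.pos_of_ne_zero hn⟩, rfl⟩

theorem sigmaN_mem_sigmaClosure (r : ℝ) {n : ℕ} (hn : n ≠ 0) : sigmaN r n ∈ sigmaClosure r :=
  subset_closure (sigmaN_mem_range r hn)

theorem exists_notMem_sigmaClosure {r a b : ℝ} (hab : a < b)
    (h : ∀ n, n ≠ 0 → sigmaN r n ≤ a ∨ b ≤ sigmaN r n) :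
    ∃ g ∉ sigmaClosure r, a < g ∧ g < b := by
  obtain ⟨g, hag, hgb⟩ := exists_between hab
  refine ⟨g, fun hg ↦ ?_, hag, hgb⟩
  have hsub : sigmaClosure r ⊆ Set.Iic a ∪ Set.Ici b := by
    refine closure_minimal ?_ (isClosed_Iic.union isClosed_Ici)
    rintro _ ⟨n, rfl⟩
    exact h n n.ne_zero
  rcases hsub hg with h' | h'
  · exact absurd h' (not_le.2 hag)
  · exact absurd h' (not_le.2 hgb)

theorem one_add_rpow_neg_le_sigmaN {r : ℝ} (hr : 0 < r) {p n : ℕ} (hn : n ≠ 0)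
    (h : ¬ Rough p n) : 1 + (p : ℝ) ^ (-r) ≤ sigmaN r n := by
  simp only [Rough, ne_eq, hn, not_false_eq_true, true_and, not_forall, not_lt] at h
  obtain ⟨q, hq, hqn, hqp⟩ := h
  refine le_trans ?_ (sigmaN_mono_dvd r hn hqn)
  rw [sigmaN_prime r hq]
  have hq0 : (0 : ℝ) < q := by exact_mod_cast hq.pos
  have hqp' : (q : ℝ) ≤ p := by exact_mod_cast hqp
  gcongr 1 + ?_
  exact Real.rpow_le_rpow_of_nonpos hq0 hqp' (by linarith)

/-- A mighty prime `p` opens a gap whose right end is `1 + p^{-r}`. -/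
theorem IsMighty.exists_gap {r : ℝ} (hr : 0 < r) {p : ℕ} (h : IsMighty r p) :
    ∃ a < 1 + (p : ℝ) ^ (-r), (∀ n, Rough p n → sigmaN r n ≤ a) ∧
      ∀ n, n ≠ 0 → sigmaN r n ≤ a ∨ 1 + (p : ℝ) ^ (-r) ≤ sigmaN r n := by
  have hm := h.2
  change tailProd r p < _ at hm
  have htop : tailProd r p ≠ ⊤ := ne_top_of_lt hm
  have hrough : ∀ n, Rough p n → sigmaN r n ≤ (tailProd r p).toReal := fun n hn ↦
    (ENNReal.ofReal_le_iff_le_toReal htop).1 (sigmaN_le_tailProd hr hn)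
  refine ⟨(tailProd r p).toReal, ?_, hrough, fun n hn ↦ ?_⟩
  · exact (ENNReal.lt_ofReal_iff_toReal_lt htop).1 hm
  · by_cases hR : Rough p n
    · exact .inl (hrough n hR)
    · exact .inr (one_add_rpow_neg_le_sigmaN hr hn hR)

theorem rough_prime {p q : ℕ} (hq : q.Prime) (h : p < q) : Rough p q := by
  simpa using rough_prime_pow hq h 1

theorem rough_two_of_odd {n : ℕ} (h : ¬ 2 ∣ n) : Rough 2 n := by
  refine ⟨by rintro rfl; simp at h, fun q hq hqn ↦ lt_of_le_of_ne hq.two_le ?_⟩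
  rintro rfl
  exact h hqn

/-- With `y = 2^{-r} ≤ 1/4`, `p^{-r} ≤ 5^{-r} ≤ (16/25) y²`, and `(1 + y) · 16/25 ≤ 4/5`, so the
product stays below `1 + y + y²`. Hence multiples of 4 lie beyond the gap below `σ(2p)`. -/
theorem one_add_two_rpow_mul_le {r : ℝ} (hr : 2 ≤ r) {p : ℕ} (hp : 5 ≤ p) :
    (1 + (2 : ℝ) ^ (-r)) * (1 + (p : ℝ) ^ (-r)) ≤ sigmaN r (2 ^ 2) := by
  have h1 : (p : ℝ) ^ (-r) ≤ ((5 : ℕ) : ℝ) ^ (-r) :=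
    Real.rpow_le_rpow_of_nonpos (by norm_num) (by exact_mod_cast hp) (by linarith)
  have h4 : ((4 : ℕ) : ℝ) ^ (-r) = ((2 : ℝ) ^ (-r)) ^ 2 := by
    rw [← Real.rpow_natCast, ← Real.rpow_mul (by norm_num), mul_comm,
      Real.rpow_mul (by norm_num)]
    norm_num
  have h2 : (2 : ℝ) ^ (-r) ≤ 1 / 4 := by
    calc (2 : ℝ) ^ (-r) ≤ (2 : ℝ) ^ (-2 : ℝ) :=
          Real.rpow_le_rpow_of_exponent_le (by norm_num) (by linarith)
      _ = 1 / 4 := by norm_num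
  have h5 : ((5 : ℕ) : ℝ) ^ (-r) ≤ ((4 : ℕ) : ℝ) ^ (-r) * (16 / 25) := by
    rw [rpow_neg_eq_mul_div_rpow r (p := 4) (by norm_num)]
    refine mul_le_mul_of_nonneg_left ?_ (by positivity)
    calc (((4 : ℕ) : ℝ) / ((5 : ℕ) : ℝ)) ^ r ≤ (((4 : ℕ) : ℝ) / ((5 : ℕ) : ℝ)) ^ (2 : ℝ) :=
          Real.rpow_le_rpow_of_exponent_ge (by norm_num) (by norm_num) hr
      _ = 16 / 25 := by norm_num
  rw [h4] at h5
  rw [sigmaN_prime_pow r Nat.prime_two]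
  simp only [Finset.sum_range_succ, Finset.sum_range_zero, Nat.cast_ofNat]
  have h0 : 0 < (2 : ℝ) ^ (-r) := by positivity
  set y := (2 : ℝ) ^ (-r)
  have : (1 + y) * (1 + (p : ℝ) ^ (-r)) ≤ (1 + y) * (1 + y ^ 2 * (16 / 25)) := by
    gcongr
    exact h1.trans h5
  nlinarith [mul_nonneg (sq_nonneg y) (sub_nonneg.2 h2)]

theorem five_le_numComponents {r : ℝ} (hr : 2 ≤ r) {p : ℕ} (hp5 : 5 ≤ p) (hp : IsMighty r p) :
    5 ≤ numComponents r := by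
  have hr0 : 0 < r := by linarith
  obtain ⟨a, ha, haR, hag⟩ := hp.exists_gap hr0
  obtain ⟨b, hb, hbR, hbg⟩ := (isMighty_three hr).exists_gap hr0
  obtain ⟨c, hc, hcR, hcg⟩ := (isMighty_two hr).exists_gap hr0
  rw [← sigmaN_prime r hp.1] at ha hag
  rw [← sigmaN_prime r Nat.prime_three] at hb hbg
  rw [← sigmaN_prime r Nat.prime_two] at hc hcg
  have ha1 : 1 ≤ a := by simpa using haR 1 (rough_one p)
  have hcop : (2 : ℕ).Coprime p := (Nat.coprime_primes Nat.prime_two hp.1).2 (by omega)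
  have h2 := one_le_sigmaN r (n := 2) (by norm_num)
  -- The fourth gap, by the power of 2 in `n`: odd `n` lie below it by the gap of 2, a single factor
  -- 2 scales the gap of `p`, and multiples of 4 lie at or above `σ(2p)`.
  have hdg : ∀ n, n ≠ 0 → sigmaN r n ≤ sigmaN r 2 * a ∨ sigmaN r (2 * p) ≤ sigmaN r n := by
    intro n hn
    obtain ⟨k, m, hm, rfl⟩ := Nat.exists_eq_pow_mul_and_not_dvd hn 2 (by norm_num)
    have hR := rough_two_of_odd hm
    match k with
    | 0 =>
      left
      rw [pow_zero, one_mul]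
      have := hcR m hR
      nlinarith
    | 1 =>
      rw [pow_one, sigmaN_mul r hcop,
        sigmaN_mul r (by simpa using hR.coprime_pow Nat.prime_two le_rfl 1)]
      exact (hag m hR.1).imp (fun h ↦ by gcongr) (fun h ↦ by gcongr)
    | k + 2 =>
      right
      rw [sigmaN_mul r hcop, sigmaN_prime r Nat.prime_two, sigmaN_prime r hp.1]
      refine (one_add_two_rpow_mul_le hr hp5).trans (sigmaN_mono_dvd r hn ?_)
      exact (pow_dvd_pow 2 (by omega)).trans (dvd_mul_right _ _)
  have hd : sigmaN r 2 * a < sigmaN r (2 * p) := by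
    rw [sigmaN_mul r hcop]
    gcongr
  have hp0 := hp.1.ne_zero
  refine succ_le_card_connectedComponents (n := 4)
    ![sigmaN r 1, sigmaN r p, sigmaN r 3, sigmaN r 2, sigmaN r (2 * p)] (fun i ↦ ?_) fun i ↦ ?_
  · fin_cases i <;> refine sigmaN_mem_sigmaClosure r ?_ <;> simp [hp0]
  · have key : ∀ {x a b : ℝ}, x ≤ a → a < b → (∀ n, n ≠ 0 → sigmaN r n ≤ a ∨ b ≤ sigmaN r n) →
        ∃ g ∉ sigmaClosure r, x < g ∧ g < b := fun hx hab h ↦ by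
      obtain ⟨g, hg, h1, h2⟩ := exists_notMem_sigmaClosure hab h
      exact ⟨g, hg, hx.trans_lt h1, h2⟩
    fin_cases i
    · exact key (by simpa using ha1) ha hag
    · exact key (hbR p (rough_prime hp.1 (by omega))) hb hbg
    · exact key (hcR 3 (rough_prime Nat.prime_three (by norm_num))) hc hcg
    · exact key (le_mul_of_one_le_right (zero_le_one.trans h2) ha1) hd hdg

/-! ### The greedy algorithm: no gaps without mighty primes -/

theorem eulerFactor_le_exp {r : ℝ} (hr : 1 ≤ r) {q : ℕ} (hq : q.Prime) :
    eulerFactor r q ≤ Real.exp (2 * (q : ℝ) ^ (-r)) := by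
  have h1 := rpow_neg_le_half hr hq.one_lt
  have h0 : 0 ≤ (q : ℝ) ^ (-r) := by positivity
  have h2 := Real.add_one_le_exp (2 * (q : ℝ) ^ (-r))
  refine le_trans ?_ h2
  rw [eulerFactor, div_le_iff₀ (by linarith)]
  nlinarith

theorem exists_tailProd_le {r : ℝ} (hr : 1 < r) (p : ℕ) {c : ℝ} (hc : 1 < c) :
    ∃ N, p ≤ N ∧ tailProd r N ≤ ENNReal.ofReal c := by
  have hs : Summable fun n : ℕ ↦ (n : ℝ) ^ (-r) := Real.summable_nat_rpow.2 (neg_lt_neg hr)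
  obtain ⟨s, hs⟩ := summable_iff_vanishing_norm.1 hs (Real.log c / 2)
    (by have := Real.log_pos hc; positivity)
  refine ⟨max p (s.sup id), le_max_left _ _, tailProd_le (by linarith) fun F hF ↦ ?_⟩
  refine ENNReal.ofReal_le_ofReal ?_
  have hdisj : Disjoint F s := by
    rw [Finset.disjoint_left]
    intro q hq hqs
    have h1 := (hF q hq).2
    have h2 : q ≤ s.sup id := Finset.le_sup (f := id) hqs
    have := le_max_right p (s.sup id)
    omega
  have hsum := (le_abs_self _).trans (hs F hdisj).le
  calc ∏ q ∈ F, eulerFactor r q ≤ ∏ q ∈ F, Real.exp (2 * (q : ℝ) ^ (-r)) :=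
        Finset.prod_le_prod
          (fun q hq ↦ zero_le_one.trans (one_le_eulerFactor (by linarith) (hF q hq).1))
          fun q hq ↦ eulerFactor_le_exp hr.le (hF q hq).1
    _ = Real.exp (2 * ∑ q ∈ F, (q : ℝ) ^ (-r)) := by rw [← Real.exp_sum, Finset.mul_sum]
    _ ≤ Real.exp (Real.log c) := Real.exp_le_exp.2 (by linarith)
    _ = c := Real.exp_log (by linarith)

theorem tailProd_le_succ {r : ℝ} (hr : 0 < r) {N : ℕ} (h : ¬ (N + 1).Prime) :
    tailProd r N ≤ tailProd r (N + 1) :=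
  tailProd_le hr fun F hF ↦ prod_le_tailProd hr F fun q hq ↦ by
    obtain ⟨h1, h2⟩ := hF q hq
    refine ⟨h1, lt_of_le_of_ne h2 ?_⟩
    rintro rfl
    exact h h1

theorem tailProd_le_mul {r : ℝ} (hr : 0 < r) {N : ℕ} (h : (N + 1).Prime) :
    tailProd r N ≤ ENNReal.ofReal (eulerFactor r (N + 1)) * tailProd r (N + 1) := by
  refine tailProd_le hr fun F hF ↦ ?_
  have h0 := zero_le_one.trans (one_le_eulerFactor hr h)
  have h1 : ∏ q ∈ F, eulerFactor r q ≤
      eulerFactor r (N + 1) * ∏ q ∈ F.erase (N + 1), eulerFactor r q := by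
    by_cases hN : N + 1 ∈ F
    · rw [Finset.mul_prod_erase _ _ hN]
    · rw [Finset.erase_eq_of_notMem hN]
      refine le_mul_of_one_le_left (Finset.prod_nonneg fun q hq ↦ ?_) (one_le_eulerFactor hr h)
      exact zero_le_one.trans (one_le_eulerFactor hr (hF q hq).1)
  refine (ENNReal.ofReal_le_ofReal h1).trans ?_
  rw [ENNReal.ofReal_mul h0]
  gcongr
  refine prod_le_tailProd hr _ fun q hq ↦ ?_
  rw [Finset.mem_erase] at hq
  obtain ⟨h3, h4⟩ := hF q hq.2
  exact ⟨h3, lt_of_le_of_ne h4 hq.1.symm⟩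

/-- One greedy step: choose the exponent of a prime `q` that is not mighty. -/
theorem exists_pow_greedy {r : ℝ} (hr : 0 < r) {q : ℕ} (hq : q.Prime) (hnm : ¬ IsMighty r q)
    {s t : ℝ} (hs : 0 < s) (hst : s ≤ t)
    (h : ENNReal.ofReal t <
      ENNReal.ofReal s * (ENNReal.ofReal (eulerFactor r q) * tailProd r q)) :
    ∃ k, s * sigmaN r (q ^ k) ≤ t ∧
      ENNReal.ofReal t < ENNReal.ofReal (s * sigmaN r (q ^ k)) * tailProd r q := by
  have hg := one_le_eulerFactor hr hq
  by_cases hall : ∀ k, s * sigmaN r (q ^ k) ≤ t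
  · have hlim : Filter.Tendsto
        (fun k ↦ ENNReal.ofReal (s * sigmaN r (q ^ k)) * tailProd r q) Filter.atTop
        (nhds (ENNReal.ofReal (s * eulerFactor r q) * tailProd r q)) := by
      refine ENNReal.Tendsto.mul_const ?_ (.inl ?_)
      · exact ENNReal.tendsto_ofReal ((sigmaN_prime_pow_tendsto hr hq).const_mul s)
      · exact (ENNReal.ofReal_pos.2 (mul_pos hs (by linarith))).ne'
    rw [← mul_assoc, ← ENNReal.ofReal_mul hs.le] at h
    obtain ⟨k, hk⟩ := (hlim.eventually (lt_mem_nhds h)).exists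
    exact ⟨k, hall k, hk⟩
  · push Not at hall
    classical
    -- `k` is the first exponent that overshoots `t`; its predecessor is the one to keep. The last
    -- step multiplied by at most `1 + q^{-r}`, which the remaining tail product can make up since
    -- `q` is not mighty.
    obtain ⟨k, hk, hmin⟩ : ∃ k, t < s * sigmaN r (q ^ k) ∧
        ∀ l < k, ¬ t < s * sigmaN r (q ^ l) :=
      ⟨Nat.find hall, Nat.find_spec hall, fun l hl ↦ Nat.find_min hall hl⟩
    match k, hk, hmin with
    | 0, hk, _ =>
      rw [pow_zero, sigmaN_one, mul_one] at hk
      exact absurd hk (not_lt.2 hst)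
    | k + 1, hk, hmin =>
      refine ⟨k, not_lt.1 (hmin k k.lt_succ_self), ?_⟩
      have hσ := one_le_sigmaN r (n := q ^ k) (pow_ne_zero _ hq.ne_zero)
      have hx0 : 0 ≤ (q : ℝ) ^ (-r) := by positivity
      have hx1 := rpow_neg_lt_one hr hq.one_lt
      have hstep := sigmaN_prime_pow_succ_le (r := r) hq k
      have hpow : ((q : ℝ) ^ (-r)) ^ (k + 1) ≤ (q : ℝ) ^ (-r) :=
        pow_le_of_le_one hx0 hx1.le (by omega)
      have hlt : t < s * sigmaN r (q ^ k) * (1 + (q : ℝ) ^ (-r)) := by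
        refine hk.trans_le ?_
        rw [mul_assoc]
        gcongr
        exact hstep.trans (by gcongr)
      calc ENNReal.ofReal t < ENNReal.ofReal (s * sigmaN r (q ^ k) * (1 + (q : ℝ) ^ (-r))) :=
            (ENNReal.ofReal_lt_ofReal_iff (by positivity)).2 hlt
        _ = ENNReal.ofReal (s * sigmaN r (q ^ k)) * ENNReal.ofReal (1 + (q : ℝ) ^ (-r)) :=
            ENNReal.ofReal_mul (by positivity)
        _ ≤ _ := by gcongr; exact tailProd_ge_of_not_isMighty hq hnm

/-- The invariant is `σ(n) ≤ t < σ(n) · tailProd r N`: the target stays within reach of the primes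
not yet used. -/
theorem exists_rough_greedy {r : ℝ} (hr : 0 < r) {p : ℕ}
    (hnm : ∀ q, p < q → ¬ IsMighty r q) {t : ℝ} (ht : 1 ≤ t)
    (htp : ENNReal.ofReal t < tailProd r p) {N : ℕ} (hN : p ≤ N) :
    ∃ n, Rough p n ∧ (∀ q : ℕ, q.Prime → q ∣ n → q ≤ N) ∧ sigmaN r n ≤ t ∧
      ENNReal.ofReal t < ENNReal.ofReal (sigmaN r n) * tailProd r N := by
  induction N, hN using Nat.le_induction with
  | base =>
    refine ⟨1, rough_one p, fun q hq h ↦ ?_, by simpa using ht, by simpa using htp⟩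
    exact absurd (Nat.dvd_one.1 h) hq.ne_one
  | succ N hN ih =>
    obtain ⟨n, hR, hsm, hle, hlt⟩ := ih
    by_cases hq : (N + 1).Prime
    · have hpos : 0 < sigmaN r n := zero_lt_one.trans_le (one_le_sigmaN r hR.1)
      obtain ⟨k, hk1, hk2⟩ := exists_pow_greedy hr hq (hnm _ (by omega)) hpos hle
        (hlt.trans_le (by gcongr; exact tailProd_le_mul hr hq))
      have hcop : n.Coprime ((N + 1) ^ k) :=
        ((Nat.Prime.coprime_pow_of_not_dvd hq) fun h ↦
          absurd (hsm _ hq h) (by omega))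
      rw [← sigmaN_mul r hcop] at hk1 hk2
      refine ⟨n * (N + 1) ^ k, hR.mul (rough_prime_pow hq (by omega) k), fun q hq' h ↦ ?_,
        hk1, hk2⟩
      rcases hq'.dvd_mul.1 h with h | h
      · exact (hsm q hq' h).trans N.le_succ
      · exact ((Nat.prime_dvd_prime_iff_eq hq' hq).1 (hq'.dvd_of_dvd_pow h)).le
    · exact ⟨n, hR, fun q hq' h ↦ (hsm q hq' h).trans N.le_succ, hle,
        hlt.trans_le (by gcongr; exact tailProd_le_succ hr hq)⟩

/-- The closure of the set of values `σ_{-r}(n)` over `n` with all prime factors above `p`. -/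
def roughClosure (r : ℝ) (p : ℕ) : Set ℝ := closure (sigmaN r '' {n | Rough p n})

theorem mem_roughClosure_of_one_lt {r : ℝ} (hr : 1 < r) {p : ℕ}
    (hnm : ∀ q, p < q → ¬ IsMighty r q) {t : ℝ} (ht : 1 ≤ t)
    (htp : ENNReal.ofReal t < tailProd r p) : t ∈ roughClosure r p := by
  refine Metric.mem_closure_iff.2 fun ε hε ↦ ?_
  -- Once the remaining tail product is at most `1 + ε / t`, the invariant puts `σ(n)` within `ε` of
  -- `t`.
  have hc : 1 < 1 + ε / t := by
    have : 0 < ε / t := div_pos hε (by linarith)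
    linarith
  obtain ⟨N, hN, hNc⟩ := exists_tailProd_le hr p hc
  obtain ⟨n, hR, -, hle, hlt⟩ := exists_rough_greedy (by linarith) hnm ht htp hN
  refine ⟨_, ⟨n, hR, rfl⟩, ?_⟩
  have h1 := one_le_sigmaN r hR.1
  have h2 : ENNReal.ofReal t < ENNReal.ofReal (sigmaN r n * (1 + ε / t)) := by
    rw [ENNReal.ofReal_mul (by linarith)]
    exact hlt.trans_le (by gcongr)
  have h3 := (ENNReal.ofReal_lt_ofReal_iff (by nlinarith)).1 h2
  have h4 : sigmaN r n * (ε / t) ≤ ε := by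
    rw [mul_div_assoc', div_le_iff₀ (by linarith)]
    nlinarith
  rw [Real.dist_eq, abs_of_nonneg (by linarith)]
  linarith

/-- If an `ε`-neighbourhood of `t` were missed, multiplying by distinct primes above `t / ε` would
increase `σ` by at most `ε` each time and never get past `t`. This would bound the sum of the
reciprocals of the primes. -/
theorem mem_roughClosure_one (p : ℕ) {t : ℝ} (ht : 1 ≤ t) : t ∈ roughClosure 1 p := by
  by_contra hcon
  simp only [roughClosure, Metric.mem_closure_iff, not_forall, not_exists, not_and, not_lt] at hcon
  obtain ⟨ε, hε, hgap⟩ := hcon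
  have hgap' : ∀ n, Rough p n → sigmaN 1 n ≤ t → sigmaN 1 n ≤ t - ε := by
    intro n hn hnt
    have := hgap _ ⟨n, hn, rfl⟩
    rw [Real.dist_eq, abs_of_nonneg (by linarith)] at this
    linarith
  obtain ⟨Q, hQ⟩ := exists_nat_gt (t / ε)
  have hbound : ∀ F : Finset ℕ, (∀ q ∈ F, q.Prime ∧ max p Q < q) →
      sigmaN 1 (∏ q ∈ F, q) ≤ t := by
    intro F
    induction F using Finset.induction_on with
    | empty => intro _; simpa using ht
    | insert q F hq ih =>
      intro hF
      have hF' : ∀ q ∈ F, q.Prime ∧ max p Q < q := fun x hx ↦ hF x (Finset.mem_insert_of_mem hx)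
      obtain ⟨hqp, hqQ⟩ := hF q (Finset.mem_insert_self q F)
      have hR : Rough p (∏ q ∈ F, q) := by
        simpa using rough_prod_pow F (fun q hq ↦
          ⟨(hF' q hq).1, (le_max_left p Q).trans_lt (hF' q hq).2⟩) 1
      have h1 := hgap' _ hR (ih hF')
      have h0 := one_le_sigmaN 1 hR.1
      have hcop : q.Coprime (∏ q ∈ F, q) := by
        simpa using coprime_prod_pow (fun x hx ↦ (hF' x hx).1) hqp hq 1 1
      rw [Finset.prod_insert hq, sigmaN_mul _ hcop, sigmaN_prime _ hqp, Real.rpow_neg_one]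
      have hq0 : (0 : ℝ) < q := by exact_mod_cast hqp.pos
      have hqQ' : (Q : ℝ) ≤ q := by exact_mod_cast (le_max_right p Q).trans hqQ.le
      have h2 : t * (q : ℝ)⁻¹ ≤ ε := by
        rw [← div_eq_mul_inv, div_le_iff₀ hq0]
        rw [div_lt_iff₀ hε] at hQ
        nlinarith
      have h3 : 0 < (q : ℝ)⁻¹ := by positivity
      nlinarith
  have hsum : ∀ F : Finset ℕ, (∀ q ∈ F, q.Prime ∧ max p Q < q) →
      ∑ q ∈ F, (1 : ℝ) / q ≤ t := by
    intro F hF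
    have h1 := sigmaN_prod_pow 1 F (fun q hq ↦ (hF q hq).1) 1
    simp only [pow_one] at h1
    have h2 := one_add_sum_le_prod_one_add F (f := fun q ↦ (1 : ℝ) / q) fun _ _ ↦ by positivity
    have h3 : ∏ q ∈ F, sigmaN 1 q = ∏ q ∈ F, (1 + (1 : ℝ) / q) :=
      Finset.prod_congr rfl fun q hq ↦ by
        rw [sigmaN_prime _ (hF q hq).1, Real.rpow_neg_one, one_div]
    have h4 := hbound F hF
    rw [h1, h3] at h4
    linarith
  refine Nat.Primes.not_summable_one_div (summable_of_sum_le
    (c := t + ∑ q ∈ Finset.range (max p Q + 1), (1 : ℝ) / q) (fun q ↦ by positivity) fun F ↦ ?_)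
  set G : Finset ℕ := F.map ⟨fun q : Nat.Primes ↦ (q : ℕ), Nat.Primes.coe_nat_injective⟩ with hG
  have hGF : ∑ q ∈ F, (1 : ℝ) / (q : ℕ) = ∑ q ∈ G, (1 : ℝ) / q := by
    rw [hG, Finset.sum_map]; rfl
  have hGp : ∀ q ∈ G, q.Prime := by
    intro q hq
    obtain ⟨x, -, rfl⟩ := Finset.mem_map.1 hq
    exact x.2
  rw [hGF, ← Finset.sum_filter_add_sum_filter_not G (fun q ↦ max p Q < q)]
  refine add_le_add (hsum _ fun q hq ↦ ?_) (Finset.sum_le_sum_of_subset_of_nonneg ?_ ?_)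
  · rw [Finset.mem_filter] at hq
    exact ⟨hGp q hq.1, hq.2⟩
  · intro q hq
    rw [Finset.mem_filter] at hq
    rw [Finset.mem_range]
    omega
  · intros; positivity

/-- If no prime above `p` is mighty, then the closure of the values of `σ_{-r}` at `p`-rough
integers has no gaps. -/
theorem ordConnected_roughClosure {r : ℝ} (hr : 1 ≤ r) {p : ℕ}
    (hnm : ∀ q, p < q → ¬ IsMighty r q) : (roughClosure r p).OrdConnected := by
  refine ⟨fun x hx y hy z hz ↦ ?_⟩
  have hx1 : 1 ≤ x := by
    have : roughClosure r p ⊆ Set.Ici 1 := closure_minimal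
      (by rintro _ ⟨n, hn, rfl⟩; exact one_le_sigmaN r hn.1) isClosed_Ici
    exact this hx
  rcases hz.2.eq_or_lt with rfl | hzy
  · exact hy
  rcases hr.eq_or_lt with rfl | hr
  · exact mem_roughClosure_one p (hx1.trans hz.1)
  -- A value above `z` at a rough integer puts `z` below the tail product, so the greedy algorithm
  -- reaches it.
  obtain ⟨_, hzw, n, hn, rfl⟩ := mem_closure_iff.1 hy (Set.Ioi z) isOpen_Ioi hzy
  have hpos : 0 < sigmaN r n := zero_lt_one.trans_le (one_le_sigmaN r hn.1)
  exact mem_roughClosure_of_one_lt hr hnm (hx1.trans hz.1)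
    (((ENNReal.ofReal_lt_ofReal_iff hpos).2 hzw).trans_le
      (sigmaN_le_tailProd (by linarith) hn))

/-! ### At most three components when no prime above 3 is mighty -/

/-- Powers of 5 contribute nearly `1 / (1 - 5^{-r})`, and the primes above 5 nearly `1 + 5^{-r}` or
more because 5 is not mighty. -/
theorem exists_rough_three_lt_sigmaN {r : ℝ} (hr : 0 < r) (h5 : ¬ IsMighty r 5) {T : ℝ}
    (hT : T * (1 - (5 : ℝ) ^ (-r)) < 1 + (5 : ℝ) ^ (-r)) :
    ∃ n, Rough 3 n ∧ T < sigmaN r n := by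
  have hx1 : (5 : ℝ) ^ (-r) < 1 := by
    simpa using rpow_neg_lt_one hr (p := 5) (by norm_num)
  have hlim := (sigmaN_prime_pow_tendsto hr Nat.prime_five).const_mul (1 + (5 : ℝ) ^ (-r))
  have hT' : T < (1 + (5 : ℝ) ^ (-r)) * eulerFactor r 5 := by
    rw [eulerFactor, mul_one_div, Nat.cast_ofNat, lt_div_iff₀ (by linarith)]
    exact hT
  obtain ⟨k, hk⟩ := (hlim.eventually (lt_mem_nhds hT')).exists
  have hpos : 0 < sigmaN r (5 ^ k) := zero_lt_one.trans_le (one_le_sigmaN r (by positivity))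
  have hlt : ENNReal.ofReal (T / sigmaN r (5 ^ k)) < tailProd r 5 := by
    refine lt_of_lt_of_le ?_ (tailProd_ge_of_not_isMighty Nat.prime_five h5)
    rw [ENNReal.ofReal_lt_ofReal_iff (by positivity), div_lt_iff₀ hpos]
    simpa using hk
  obtain ⟨m, hm, hTm⟩ := exists_rough_lt_sigmaN hr hlt
  rw [div_lt_iff₀ hpos] at hTm
  refine ⟨m * 5 ^ k, (hm.mono (by norm_num)).mul
    (rough_prime_pow Nat.prime_five (by norm_num) k), ?_⟩
  rwa [sigmaN_mul r (hm.coprime_pow Nat.prime_five le_rfl k).symm]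

theorem Icc_subset_roughClosure_three {r : ℝ} (hr : 1 ≤ r)
    (hnm : ∀ q, 3 < q → ¬ IsMighty r q) :
    Set.Icc 1 (1 + 2 * (5 : ℝ) ^ (-r)) ⊆ roughClosure r 3 := by
  have hx0 : 0 < (5 : ℝ) ^ (-r) := by positivity
  obtain ⟨n, hn, hlt⟩ := exists_rough_three_lt_sigmaN (by linarith) (hnm 5 (by norm_num))
    (T := 1 + 2 * (5 : ℝ) ^ (-r)) (by nlinarith)
  have h1 : (1 : ℝ) ∈ roughClosure r 3 := subset_closure ⟨1, rough_one 3, sigmaN_one r⟩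
  have h2 : sigmaN r n ∈ roughClosure r 3 := subset_closure ⟨n, hn, rfl⟩
  exact (Set.Icc_subset_Icc_right hlt.le).trans
    ((ordConnected_roughClosure hr hnm).out h1 h2)

/-- Since `5/2 = 2 + 1/2`, a rational upper bound `c` for `√b` suffices. -/
theorem rpow_le_of_le_five_halves {r b c : ℝ} (hr : r ≤ 5 / 2) (hb : 1 ≤ b) (hc : 0 ≤ c)
    (h : b ≤ c ^ 2) : b ^ r ≤ b ^ 2 * c := by
  calc b ^ r ≤ b ^ ((2 : ℕ) + 1 / 2 : ℝ) :=
        Real.rpow_le_rpow_of_exponent_le hb (by push_cast; linarith)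
    _ = b ^ 2 * √b := by
        rw [Real.rpow_add (by linarith), Real.rpow_natCast, Real.sqrt_eq_rpow]
    _ ≤ b ^ 2 * c := by
        refine mul_le_mul_of_nonneg_left ?_ (by positivity)
        rwa [Real.sqrt_le_left hc]

theorem rpow_neg_sq (r : ℝ) {b : ℝ} (hb : 0 ≤ b) : (b ^ (-r)) ^ 2 = (b ^ 2) ^ (-r) := by
  rw [← Real.rpow_natCast, ← Real.rpow_mul hb, mul_comm, Real.rpow_mul hb, Real.rpow_natCast]

theorem two_rpow_neg_sq_le {r : ℝ} (hr : r ≤ 5 / 2) :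
    ((2 : ℝ) ^ (-r)) ^ 2 ≤ 2 * (5 : ℝ) ^ (-r) := by
  have h := rpow_neg_eq_mul_div_rpow r (p := 5) (n := 4) (by norm_num)
  have h1 := rpow_le_of_le_five_halves hr (b := 5 / 4) (c := 1.12) (by norm_num) (by norm_num)
    (by norm_num)
  rw [rpow_neg_sq r (by norm_num)]
  have hx0 : 0 < (5 : ℝ) ^ (-r) := by positivity
  norm_num at h h1 ⊢
  rw [h]
  nlinarith

/-- Divided by `5^{-r}`, the left side is `(5/4)^r ((4/3)^r - 1)`, which is largest at `r = 5/2`.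
This inequality makes the families with and without a factor 3 meet once a factor 2 is present. -/
theorem three_rpow_neg_sub_le {r : ℝ} (hr0 : 0 ≤ r) (hr : r ≤ 5 / 2) :
    (3 : ℝ) ^ (-r) - ((2 : ℝ) ^ (-r)) ^ 2 ≤ 2 * (5 : ℝ) ^ (-r) := by
  have h := rpow_neg_eq_mul_div_rpow r (p := 5) (n := 4) (by norm_num)
  have h' := rpow_neg_eq_mul_div_rpow r (p := 5) (n := 3) (by norm_num)
  have h1 := rpow_le_of_le_five_halves hr (b := 5 / 4) (c := 1.12) (by norm_num) (by norm_num)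
    (by norm_num)
  have h2 := rpow_le_of_le_five_halves hr (b := 4 / 3) (c := 1.155) (by norm_num) (by norm_num)
    (by norm_num)
  have h3 : (5 / 3 : ℝ) ^ r = (5 / 4 : ℝ) ^ r * (4 / 3 : ℝ) ^ r := by
    rw [← Real.mul_rpow (by norm_num) (by norm_num)]; norm_num
  have h4 : 1 ≤ (4 / 3 : ℝ) ^ r := Real.one_le_rpow (by norm_num) hr0
  have hu : 0 < (5 / 4 : ℝ) ^ r := by positivity
  rw [rpow_neg_sq r (by norm_num)]
  have hx0 : 0 < (5 : ℝ) ^ (-r) := by positivity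
  norm_num at h h' h1 h2 ⊢
  rw [h, h', h3]
  have key : (5 / 4 : ℝ) ^ r * ((4 / 3 : ℝ) ^ r - 1) ≤ 2 := by
    calc (5 / 4 : ℝ) ^ r * ((4 / 3 : ℝ) ^ r - 1) ≤ (7 / 4) * (154 / 75 - 1) :=
          mul_le_mul h1 (by linarith) (by linarith) (by norm_num)
      _ ≤ 2 := by norm_num
  nlinarith [mul_le_mul_of_nonneg_left key hx0.le]

theorem three_rpow_neg_sq_le {r : ℝ} (hr : 0 ≤ r) :
    ((3 : ℝ) ^ (-r)) ^ 2 ≤ 2 * (5 : ℝ) ^ (-r) := by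
  have hx0 : 0 < (5 : ℝ) ^ (-r) := by positivity
  have : (9 : ℝ) ^ (-r) ≤ (5 : ℝ) ^ (-r) :=
    Real.rpow_le_rpow_of_nonpos (by norm_num) (by norm_num) (by linarith)
  rw [rpow_neg_sq r (by norm_num)]
  norm_num at this ⊢
  linarith

/-- From exponent 1 on, raising the exponent multiplies `σ` by at most `1 + q^{-2r}`, so the factor
lies in the interval known to be in `J`. The step from 0 to 1 has the larger factor `1 + q^{-r}` and
is left out. -/
theorem exists_sigmaN_pow_succ_eq {r : ℝ} (hr : 0 < r) {q : ℕ} (hq : q.Prime) {δ : ℝ}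
    (h : ((q : ℝ) ^ (-r)) ^ 2 ≤ δ) (k : ℕ) :
    ∃ w ∈ Set.Icc 1 (1 + δ), sigmaN r (q ^ (k + 2)) = sigmaN r (q ^ (k + 1)) * w := by
  have hpos : 0 < sigmaN r (q ^ (k + 1)) :=
    zero_lt_one.trans_le (one_le_sigmaN r (pow_ne_zero _ hq.ne_zero))
  refine ⟨sigmaN r (q ^ (k + 2)) / sigmaN r (q ^ (k + 1)), ⟨?_, ?_⟩, by field_simp⟩
  · rw [one_le_div hpos]
    exact sigmaN_mono_dvd r (pow_ne_zero _ hq.ne_zero) (pow_dvd_pow q (by omega))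
  · rw [div_le_iff₀ hpos, mul_comm]
    refine (sigmaN_prime_pow_succ_le hq (k + 1)).trans ?_
    gcongr
    refine le_trans ?_ h
    exact pow_le_pow_of_le_one (by positivity) (rpow_neg_lt_one hr hq.one_lt).le (by omega)

theorem exists_eq_two_pow_three_pow_rough {n : ℕ} (hn : n ≠ 0) :
    ∃ j k m, Rough 3 m ∧ n = 2 ^ j * 3 ^ k * m := by
  obtain ⟨j, n', h2, rfl⟩ := Nat.exists_eq_pow_mul_and_not_dvd hn 2 (by norm_num)
  have hn' : n' ≠ 0 := by rintro rfl; simp at h2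
  obtain ⟨k, m, h3, rfl⟩ := Nat.exists_eq_pow_mul_and_not_dvd hn' 3 (by norm_num)
  refine ⟨j, k, m, ⟨by rintro rfl; simp at h3, fun q hq hqm ↦ ?_⟩, by ring⟩
  by_contra! hle
  have := hq.two_le
  interval_cases q
  · exact h2 (hqm.trans (dvd_mul_left _ _))
  · exact h3 hqm

theorem sigmaN_two_pow_mul_three_pow_mul (r : ℝ) {m : ℕ} (hm : Rough 3 m) (j k : ℕ) :
    sigmaN r (2 ^ j * 3 ^ k * m) = sigmaN r (2 ^ j) * (sigmaN r (3 ^ k) * sigmaN r m) := by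
  have h23 : (2 ^ j).Coprime (3 ^ k) := Nat.Coprime.pow _ _ (by norm_num)
  rw [mul_assoc, sigmaN_mul, sigmaN_mul]
  · exact hm.coprime_pow Nat.prime_three le_rfl k
  · exact Nat.Coprime.mul_right h23 (hm.coprime_pow Nat.prime_two (by norm_num) j)

theorem mul_mul_mem_sigmaClosure (r : ℝ) {w : ℝ} (hw : w ∈ roughClosure r 3) (j k : ℕ) :
    sigmaN r (2 ^ j) * (sigmaN r (3 ^ k) * w) ∈ sigmaClosure r := by
  refine map_mem_closure (f := fun w ↦ sigmaN r (2 ^ j) * (sigmaN r (3 ^ k) * w))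
    (by fun_prop) hw ?_
  rintro _ ⟨m, hm, rfl⟩
  beta_reduce
  rw [← sigmaN_two_pow_mul_three_pow_mul r hm]
  exact sigmaN_mem_range r (mul_ne_zero (by positivity) hm.1)

/-- Consecutive multiples of a preconnected set that overlap have a preconnected union. -/
theorem isPreconnected_iUnion_mul {J : Set ℝ} (hJ : IsPreconnected J) (c : ℕ → ℝ)
    (h : ∀ k, ∃ x ∈ J, ∃ y ∈ J, c (k + 1) * x = c k * y) :
    IsPreconnected (⋃ k, (c k * ·) '' J) := by
  refine IsPreconnected.iUnion_of_chain
    (fun k ↦ hJ.image _ (continuous_const_mul _).continuousOn) fun k ↦ ?_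
  obtain ⟨x, hx, y, hy, hxy⟩ := h k
  exact ⟨c k * y, ⟨y, hy, rfl⟩, ⟨x, hx, hxy⟩⟩

theorem numComponents_le_three {r : ℝ} (hr : 1 ≤ r) (hnm : ∀ q, 3 < q → ¬ IsMighty r q) :
    numComponents r ≤ 3 := by
  have hr0 : 0 < r := by linarith
  have hr5 : r ≤ 5 / 2 := by
    by_contra! h
    exact hnm 5 (by norm_num) (isMighty_five h.le)
  set δ := 2 * (5 : ℝ) ^ (-r) with hδ
  set J := roughClosure r 3 with hJdef
  have hJ : IsPreconnected J := (ordConnected_roughClosure hr hnm).isPreconnected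
  have hIcc : Set.Icc 1 (1 + δ) ⊆ J := Icc_subset_roughClosure_three hr hnm
  have hδ0 : 0 < δ := by positivity
  have h1J : (1 : ℝ) ∈ J := hIcc ⟨le_rfl, by linarith⟩
  have hδJ : 1 + δ ∈ J := hIcc ⟨by linarith, le_rfl⟩
  set a : ℕ → ℝ := fun j ↦ sigmaN r (2 ^ (j + 1)) with ha
  set b : ℕ → ℝ := fun k ↦ sigmaN r (3 ^ (k + 1)) with hb
  have hstep2 : ∀ j, ∃ w ∈ Set.Icc 1 (1 + δ), a (j + 1) = a j * w :=
    exists_sigmaN_pow_succ_eq hr0 Nat.prime_two (by simpa using two_rpow_neg_sq_le hr5)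
  have hstep3 : ∀ k, ∃ w ∈ Set.Icc 1 (1 + δ), b (k + 1) = b k * w :=
    exists_sigmaN_pow_succ_eq hr0 Nat.prime_three (by simpa using three_rpow_neg_sq_le hr0.le)
  set V : Set ℝ := ⋃ k, (b k * ·) '' J with hV
  have hVp : IsPreconnected V := isPreconnected_iUnion_mul hJ b fun k ↦ by
    obtain ⟨w, hw, h⟩ := hstep3 k
    exact ⟨1, h1J, w, hIcc hw, by rw [mul_one, h]⟩
  have hbJ : ∀ w ∈ J, b 0 * w ∈ V := fun w hw ↦ Set.mem_iUnion.2 ⟨0, w, hw, rfl⟩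
  set W₀ : Set ℝ := ⋃ j, (a j * ·) '' J with hW₀
  have hW₀p : IsPreconnected W₀ := isPreconnected_iUnion_mul hJ a fun k ↦ by
    obtain ⟨w, hw, h⟩ := hstep2 k
    exact ⟨1, h1J, w, hIcc hw, by rw [mul_one, h]⟩
  set W₁ : Set ℝ := ⋃ j, (a j * ·) '' V with hW₁
  have hW₁p : IsPreconnected W₁ := isPreconnected_iUnion_mul hVp a fun k ↦ by
    obtain ⟨w, hw, h⟩ := hstep2 k
    exact ⟨b 0 * 1, hbJ 1 h1J, b 0 * w, hbJ w (hIcc hw), by rw [h]; ring⟩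
  have ha0 : a 0 = 1 + (2 : ℝ) ^ (-r) := by
    simpa [ha] using sigmaN_prime r Nat.prime_two
  have hb0 : b 0 = 1 + (3 : ℝ) ^ (-r) := by
    simpa [hb] using sigmaN_prime r Nat.prime_three
  -- The common point is `σ(2) σ(3)`, the value at 6. With `y = 2^{-r}` and `z = 3^{-r}`, it lies
  -- below the supremum of the `a j * (1 + δ)` when `(1 - y²)(1 + z) < 1 + δ`, which follows from `z
  -- - y² ≤ δ`.
  have hinter : ∃ x, x ∈ W₀ ∧ x ∈ W₁ := by
    have hy0 : 0 < (2 : ℝ) ^ (-r) := by positivity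
    have hz0 : 0 < (3 : ℝ) ^ (-r) := by positivity
    have hy1 : (2 : ℝ) ^ (-r) < 1 := by
      simpa using rpow_neg_lt_one hr0 (p := 2) (by norm_num)
    have hlim : Filter.Tendsto (fun j ↦ a j * (1 + δ)) Filter.atTop
        (nhds (eulerFactor r 2 * (1 + δ))) :=
      ((sigmaN_prime_pow_tendsto hr0 Nat.prime_two).comp
        (Filter.tendsto_add_atTop_nat 1)).mul_const _
    have hlt : a 0 * b 0 < eulerFactor r 2 * (1 + δ) := by
      have := three_rpow_neg_sub_le hr0.le hr5
      rw [ha0, hb0, eulerFactor, one_div_mul_eq_div, Nat.cast_ofNat, lt_div_iff₀ (by linarith)]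
      nlinarith [mul_pos hz0 (pow_pos hy0 2)]
    obtain ⟨j, hj⟩ := (hlim.eventually (lt_mem_nhds hlt)).exists
    refine ⟨a 0 * b 0, hW₀p.ordConnected.out (x := a 0 * 1) (y := a j * (1 + δ))
      (Set.mem_iUnion.2 ⟨0, 1, h1J, rfl⟩) (Set.mem_iUnion.2 ⟨j, _, hδJ, rfl⟩) ⟨?_, hj.le⟩,
      Set.mem_iUnion.2 ⟨0, b 0, by simpa using hbJ 1 h1J, rfl⟩⟩
    rw [ha0, hb0]
    gcongr
    linarith
  obtain ⟨x, hx₀, hx₁⟩ := hinter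
  have hWp : IsPreconnected (W₀ ∪ W₁) := hW₀p.union x hx₀ hx₁ hW₁p
  have hJS : J ⊆ sigmaClosure r := fun w hw ↦ by
    simpa using mul_mul_mem_sigmaClosure r hw 0 0
  have hVS : V ⊆ sigmaClosure r := by
    refine Set.iUnion_subset fun k ↦ ?_
    rintro _ ⟨w, hw, rfl⟩
    simpa using mul_mul_mem_sigmaClosure r hw 0 (k + 1)
  have hWS : W₀ ∪ W₁ ⊆ sigmaClosure r := by
    refine Set.union_subset (Set.iUnion_subset fun j ↦ ?_) (Set.iUnion_subset fun j ↦ ?_)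
    · rintro _ ⟨w, hw, rfl⟩
      simpa using mul_mul_mem_sigmaClosure r hw (j + 1) 0
    · rintro _ ⟨v, hv, rfl⟩
      obtain ⟨k, w, hw, rfl⟩ := Set.mem_iUnion.1 hv
      exact mul_mul_mem_sigmaClosure r hw (j + 1) (k + 1)
  have hcl : ∀ {A : Set ℝ}, A ⊆ sigmaClosure r → closure A ⊆ sigmaClosure r :=
    fun h ↦ closure_minimal h isClosed_closure
  have hcover : sigmaClosure r ⊆ closure J ∪ (closure V ∪ closure (W₀ ∪ W₁)) := by
    rw [← closure_union, ← closure_union]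
    refine closure_mono ?_
    rintro _ ⟨n, rfl⟩
    rw [sigmaNeg_eq_sigmaN]
    obtain ⟨j, k, m, hm, hn⟩ := exists_eq_two_pow_three_pow_rough n.ne_zero
    rw [hn, sigmaN_two_pow_mul_three_pow_mul r hm]
    have hmJ : sigmaN r m ∈ J := subset_closure ⟨m, hm, rfl⟩
    match j, k with
    | 0, 0 => left; simpa using hmJ
    | 0, k + 1 =>
      right; left
      rw [pow_zero, sigmaN_one, one_mul]
      exact Set.mem_iUnion.2 ⟨k, _, hmJ, rfl⟩
    | j + 1, 0 =>
      right; right; left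
      rw [pow_zero, sigmaN_one, one_mul]
      exact Set.mem_iUnion.2 ⟨j, _, hmJ, rfl⟩
    | j + 1, k + 1 =>
      right; right; right
      exact Set.mem_iUnion.2 ⟨j, _, Set.mem_iUnion.2 ⟨k, _, hmJ, rfl⟩, rfl⟩
  refine card_connectedComponents_le (n := 3)
    ![closure J, closure V, closure (W₀ ∪ W₁)] (fun i ↦ ?_) (fun i ↦ ?_) fun y hy ↦ ?_
  · fin_cases i
    exacts [hJ.closure, hVp.closure, hWp.closure]
  · fin_cases i
    exacts [hcl hJS, hcl hVS, hcl hWS]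
  · rcases hcover hy with h | h | h
    exacts [⟨0, h⟩, ⟨1, h⟩, ⟨2, h⟩]

/-! ### The dichotomy -/

theorem five_le_numComponents_of_isMighty {r : ℝ} (hr : 1 ≤ r) {p : ℕ} (h5 : 5 ≤ p)
    (hp : IsMighty r p) : 5 ≤ numComponents r := by
  refine five_le_numComponents (le_of_not_ge fun h ↦ ?_) h5 hp
  exact not_isMighty_of_le_two (by linarith) h h5 hp

theorem IsMighty.five_le {r : ℝ} {p : ℕ} (hp : IsMighty r p) (h : 3 < p) : 5 ≤ p := by
  have h4 : p ≠ 4 := by rintro rfl; exact absurd hp.1 (by norm_num)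
  omega

theorem mainTheorem4 (r : ℝ) (hr : 1 ≤ r) :
    numComponents r ≠ 4 ∧
      (IsGreatest {p : ℕ | IsMighty r p} 3 → numComponents r ≤ 3) ∧
      (3 ≤ {p : ℕ | IsMighty r p}.encard → 5 ≤ numComponents r) := by
  refine ⟨fun h ↦ ?_, fun h ↦ numComponents_le_three hr fun q hq hm ↦ ?_, fun h ↦ ?_⟩
  · by_cases hm : ∀ q, 3 < q → ¬ IsMighty r q
    · have := numComponents_le_three hr hm
      rw [h] at this
      exact absurd this (by decide)
    · push Not at hm
      obtain ⟨q, hq, hm⟩ := hm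
      have := five_le_numComponents_of_isMighty hr (hm.five_le hq) hm
      rw [h] at this
      exact absurd this (by decide)
  · exact absurd (h.2 hm) (not_le.2 hq)
  · by_contra hcon
    have hsub : {p : ℕ | IsMighty r p} ⊆ {2, 3} := by
      intro q hq
      have h2 := (show IsMighty r q from hq).1.two_le
      have h3 : ¬ 3 < q := fun h3 ↦
        hcon (five_le_numComponents_of_isMighty hr (IsMighty.five_le hq h3) hq)
      have : q = 2 ∨ q = 3 := by omega
      simpa using this
    have := h.trans (Set.encard_le_encard hsub)
    rw [Set.encard_pair (by norm_num)] at this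
    exact absurd this (by decide)
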